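/- Let $(\Omega,\Sigma,\mathbb P)$ be a probability space and consider $$\inf_{x\in\mathbb R^n} f(x),\qquad f(x)=\mathbb E_s[g(x,s)-h(x,s)]+r_1(x)-r_2(x),$$ where $g(\cdot,s),h(\cdot,s)$ $(s\in\Omega)$ are finite continuous convex functions on $\mathbb R^n$ with $G(x)=\mathbb E_s[g(x,s)]$ and $H(x)=\mathbb E_s[h(x,s)]$ finite for all $x$, and $r_1,r_2:\mathbb R^n\to\mathbb R\cup\{+\infty\}$ are convex and lower semicontinuous (convention $(+\infty)-(+\infty)=+\infty$). A point $x$ is called critical if $0\in D(x):=\partial G(x)+\partial r_1(x)-\partial H(x)-\partial r_2(x)$, with the subdifferentials of convex analysis. The strong convexity modulus $\rho(\varphi)\in[0,+\infty]$ of $\varphi$ is the supremum of the $\rho\ge0$ such that $\varphi(\lambda x+(1-\lambda)y)\le\lambda\varphi(x)+(1-\lambda)\varphi(y)-\frac{\rho}{2}\lambda(1-\lambda)\|x-y\|^2$ for all $x,y$ and all $\lambda\in[0,1]$. **Weights.** Let $\alpha_k>0$, $A_k=\sum_{i=0}^k\alpha_i\to\infty$, $\beta_k=A_k/\big(\sum_{i=0}^k\alpha_i^2\big)^{1/2}$.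 Assume that $\sum_{k\ge1}\frac{\alpha_k(1+\sqrt{\ln\beta_{k-1}})}{\beta_{k-1}A_k}<\infty$ and that for some $N,\gamma>0$ one has $\sum_{i=0}^k\alpha_i^2/A_k^2\le N/k^\gamma$ for all $k\ge1$, where either $\gamma>1/2$ or $A_l/A_k\to1$ as $k,l\to\infty$ with $l/k\to1$. **Algorithms.** Start from $x^0$ with $r_1(x^0)<+\infty$. At step $k=0,1,\dots$ draw $s^k$ with law $\mathbb P$ (the $s^k$ are i.i.d., and $s^k$ is independent of $s^0,\dots,s^{k-1},x^0,\dots,x^k$), choose $z^k_i\in\partial h(\cdot,s^i)(x^k)$ for $i=0,\dots,k$ and $w^k\in\partial r_2(x^k)$, put $y^k=\frac1{A_k}\sum_{i=0}^k\alpha_iz^k_i$, and let $x^{k+1}$ be a minimizer over $\mathbb R^n$ of - (Algorithm 3) $x\mapsto G(x)+r_1(x)-\langle y^k+w^k,x\rangle$; - (Algorithm 4) $x\mapsto G_k(x)+r_1(x)-\langle y^k+w^k,x\rangle$, where $G_k(x)=\frac1{A_k}\sum_{i=0}^k\alpha_ig(x,s^i)$. **Theorem.** Let $(x^k)$ be generated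 by Algorithm 3 or by Algorithm 4. For Algorithm 3 assume (A1): for each $x$, $h(x,\cdot)$ is bounded on $\Omega$ and the family $\{h(\cdot,s)\}_{s\in\Omega}$ is equicontinuous at $x$. For Algorithm 4 assume (A2): the same for both $g$ and $h$. Assume that $\inf f$ is finite, that almost surely $(x^k)$ is bounded, and that $\inf_{s\in\Omega}\rho(h(\cdot,s))+\rho(r_2)>0$. Then: (i) Almost surely $f(x^k)$ converges to a finite limit and $\sum_{k=0}^\infty\|x^{k+1}-x^k\|^2<\infty$. Moreover, for almost every outcome for which the sequence $(w^k)$ is bounded, every limit point of $(x^k)$ is critical. In particular, if $(w^k)$ is almost surely bounded, then almost surely every limit point of $(x^k)$ is critical. (ii) Let $C$ be a compact set which almost surely contains all $x^k$, and suppose that $r_2$, the functions $h(\cdot,s)$ and, for Algorithm 4, also the functions $g(\cdot,s)$ $(s\in\Omega)$ are differentiable at the points of $C$ with gradients that are Lipschitz on $C$ with a common modulus $L/2$. Let $d_k=\min_{1\le i\le k}\mathbb E\big[d(0,D(x^i))\big]$. Then, as $k\to\infty$, $$d_k^2=O\Big(\frac1k\sum_{i=1}^k\frac{(1+\sqrt{\ln\beta_{i-1}})^2}{\beta_{i-1}^2}\Big),$$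 and if $\alpha_k=1$ for all $k$, then $d_k=O(\ln k/\sqrt k)$. -/

import Mathlib

open MeasureTheory ProbabilityTheory Filter Topology
open scoped NNReal ENNReal Pointwise

noncomputable section

namespace SDC

/-- The Euclidean space `ℝⁿ`. -/
abbrev E (n : ℕ) := EuclideanSpace ℝ (Fin n)

/-! Convex analysis for extended-real-valued functions. -/

/-- `ρ`-convexity of an extended-real-valued function (`ρ = 0` is convexity). -/
def RhoConvex {n : ℕ} (ρ : ℝ≥0) (φ : E n → EReal) : Prop :=
  ∀ x y : E n, ∀ t : ℝ, 0 ≤ t → t ≤ 1 →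
    φ (t • x + (1 - t) • y) ≤
      (t : EReal) * φ x + ((1 - t : ℝ) : EReal) * φ y
        - (((ρ : ℝ) / 2 * t * (1 - t) * ‖x - y‖ ^ 2 : ℝ) : EReal)

/-- The strong convexity modulus: the supremum of all `ρ ≥ 0` for which `φ` is `ρ`-convex. -/
def strongConvexityModulus {n : ℕ} (φ : E n → EReal) : ℝ≥0∞ :=
  ⨆ (ρ : ℝ≥0) (_ : RhoConvex ρ φ), (ρ : ℝ≥0∞)

/-- The subdifferential of convex analysis; it is empty outside the effective domain. -/
def subdiff {n : ℕ} (φ : E n → EReal) (x : E n) : Set (E n) :=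
  {v | φ x ≠ ⊤ ∧ ∀ y : E n, φ x + ((inner ℝ v (y - x) : ℝ) : EReal) ≤ φ y}

/-- A real-valued function, seen as an extended-real-valued one. -/
def ext {n : ℕ} (φ : E n → ℝ) : E n → EReal := fun x => (φ x : EReal)

/-- `φ` is finite near, and differentiable at, every point of `C`, and its gradient is Lipschitz
on `C` with modulus `K`. -/
def HasLipschitzGradientOn {n : ℕ} (φ : E n → EReal) (K : ℝ≥0) (C : Set (E n)) : Prop :=
  (∀ x ∈ C, (∀ᶠ y in 𝓝 x, φ y ≠ ⊤ ∧ φ y ≠ ⊥) ∧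
    DifferentiableAt ℝ (fun y => (φ y).toReal) x) ∧
  LipschitzOnWith K (gradient fun y => (φ y).toReal) C

/-- For each `x` the function `u x` is bounded on `Ω`, and the functions `u · s`, `s ∈ Ω`, are
equi-continuous at each `x`. -/
def BoundedEquicontinuous {n : ℕ} {Ω : Type*} (u : E n → Ω → ℝ) : Prop :=
  (∀ x : E n, ∃ M : ℝ, ∀ s : Ω, |u x s| ≤ M) ∧
  (∀ x : E n, ∀ ε > 0, ∃ δ > 0, ∀ y ∈ Metric.ball x δ, ∀ s : Ω, |u y s - u x s| ≤ ε)

/-! The weights. -/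

/-- `A_k = α_0 + ... + α_k`. -/
def weightSum (a : ℕ → ℝ) (k : ℕ) : ℝ := ∑ i ∈ Finset.range (k + 1), a i

/-- `β_k = A_k / (α_0² + ... + α_k²)^{1/2}`. -/
def beta (a : ℕ → ℝ) (k : ℕ) : ℝ :=
  weightSum a k / Real.sqrt (∑ i ∈ Finset.range (k + 1), a i ^ 2)

/-- The weighted average `(1 / A_k) ∑_{i ≤ k} α_i v_i`. -/
def weightedAvg {V : Type*} [AddCommGroup V] [Module ℝ V] (a : ℕ → ℝ) (k : ℕ) (v : ℕ → V) : V :=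
  (weightSum a k)⁻¹ • ∑ i ∈ Finset.range (k + 1), a i • v i

/-- The conditions on the weights. In the last one the limit is along pairs `(k, l)` with
`k, l → ∞` and `l / k → 1`. -/
structure AdmissibleWeights (a : ℕ → ℝ) : Prop where
  pos : ∀ k, 0 < a k
  sum_infinite : Tendsto (weightSum a) atTop atTop
  summable : Summable fun k : ℕ =>
    a (k + 1) * (1 + Real.sqrt (Real.log (beta a k))) / (beta a k * weightSum a (k + 1))
  decay : ∃ N γ : ℝ, 0 < N ∧ 0 < γ ∧
    (∀ k : ℕ, 1 ≤ k →
      (∑ i ∈ Finset.range (k + 1), a i ^ 2) / weightSum a k ^ 2 ≤ N / (k : ℝ) ^ γ) ∧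
    (1 / 2 < γ ∨
      Tendsto (fun q : ℕ × ℕ => weightSum a q.2 / weightSum a q.1)
        (atTop ⊓ comap (fun q : ℕ × ℕ => (q.2 : ℝ) / (q.1 : ℝ)) (𝓝 1)) (𝓝 1))

/-! The stochastic DC program. -/

/-- The data of a stochastic DC program on `ℝⁿ` with sample space `(Ω, P)`, with the standing
assumptions. -/
structure Program (n : ℕ) {Ω : Type*} [MeasurableSpace Ω] (P : Measure Ω) where
  g : E n → Ω → ℝ
  h : E n → Ω → ℝ
  r₁ : E n → EReal
  r₂ : E n → EReal
  g_convex : ∀ s, ConvexOn ℝ Set.univ fun x => g x s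
  h_convex : ∀ s, ConvexOn ℝ Set.univ fun x => h x s
  g_continuous : ∀ s, Continuous fun x => g x s
  h_continuous : ∀ s, Continuous fun x => h x s
  g_integrable : ∀ x, Integrable (g x) P
  h_integrable : ∀ x, Integrable (h x) P
  r₁_ne_bot : ∀ x, r₁ x ≠ ⊥
  r₂_ne_bot : ∀ x, r₂ x ≠ ⊥
  r₁_convex : RhoConvex 0 r₁
  r₂_convex : RhoConvex 0 r₂
  r₁_lsc : LowerSemicontinuous r₁
  r₂_lsc : LowerSemicontinuous r₂

/-- The two schemes, which differ in how the first DC component enters the subproblem. -/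
inductive Scheme where
  | sdca3
  | sdca4

namespace Program

variable {n : ℕ} {Ω : Type*} [MeasurableSpace Ω] {P : Measure Ω} (p : Program n P)

/-- `G(x) = 𝔼 g(x, s)`. -/
def G (x : E n) : ℝ := ∫ s, p.g x s ∂P

/-- `H(x) = 𝔼 h(x, s)`. -/
def H (x : E n) : ℝ := ∫ s, p.h x s ∂P

open Classical in
/-- The objective `f = 𝔼 [g(·, s) - h(·, s)] + r₁ - r₂`, with the convention
`(+∞) - (+∞) = +∞`. -/
def objective (x : E n) : EReal :=
  if p.r₁ x = ⊤ then ⊤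
  else ((∫ s, (p.g x s - p.h x s) ∂P : ℝ) : EReal) + (p.r₁ x - p.r₂ x)

/-- The optimal value is finite. -/
def FiniteOptimalValue : Prop := ∃ α : ℝ, ⨅ x, p.objective x = (α : EReal)

/-- The set `∂G(x) + ∂r₁(x) - ∂H(x) - ∂r₂(x)`. -/
def residual (x : E n) : Set (E n) :=
  subdiff (ext p.G) x + subdiff p.r₁ x - subdiff (ext p.H) x - subdiff p.r₂ x

/-- (DC) critical points. -/
def IsCritical (x : E n) : Prop := (0 : E n) ∈ p.residual x

/-- `ρ = inf_s ρ(h(·, s)) + ρ(r₂)`. -/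
def modulus : ℝ≥0∞ :=
  (⨅ s : Ω, strongConvexityModulus (ext fun x => p.h x s)) + strongConvexityModulus p.r₂

/-- Assumption (A1) for the first scheme and (A2) for the second. -/
def Regular : Scheme → Prop
  | .sdca3 => BoundedEquicontinuous p.h
  | .sdca4 => BoundedEquicontinuous p.g ∧ BoundedEquicontinuous p.h

/-- The first DC component used at step `k` for the samples `σ 0, ..., σ k`: it is `G` for the
first scheme and the weighted sample average `G_k` for the second. -/
def firstComponent (a : ℕ → ℝ) (σ : ℕ → Ω) (k : ℕ) : Scheme → E n → ℝ
  | .sdca3 => p.G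
  | .sdca4 => fun v => weightedAvg a k fun i => p.g v (σ i)

/-- The gradients of `r₂`, of the `h(·, s)` and, for the second scheme, of the `g(·, s)` are
Lipschitz on `C` with the common modulus `L / 2`. -/
def EquiLipschitzGradients (L : ℝ≥0) (C : Set (E n)) : Scheme → Prop
  | .sdca3 => HasLipschitzGradientOn p.r₂ (L / 2) C ∧
      ∀ s, HasLipschitzGradientOn (ext fun x => p.h x s) (L / 2) C
  | .sdca4 => HasLipschitzGradientOn p.r₂ (L / 2) C ∧
      (∀ s, HasLipschitzGradientOn (ext fun x => p.h x s) (L / 2) C) ∧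
      ∀ s, HasLipschitzGradientOn (ext fun x => p.g x s) (L / 2) C

end Program

/-- The σ-algebra generated by `s⁰, ..., s^{k-1}` and `x⁰, ..., x^k`. -/
abbrev history {n : ℕ} {Ω Ω' : Type*} [MeasurableSpace Ω]
    (s : ℕ → Ω' → Ω) (x : ℕ → Ω' → E n) (k : ℕ) : MeasurableSpace Ω' :=
  (⨆ i : ℕ, ⨆ _ : i < k, MeasurableSpace.comap (s i) inferInstance) ⊔
    ⨆ i : ℕ, ⨆ _ : i ≤ k, MeasurableSpace.comap (x i) inferInstance

/-- `x` is a sequence of iterates generated by the given scheme on the probability space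
`(Ω', μ)`, from the starting point `x₀`, with samples `s`, subgradients
`z k i ∈ ∂h(·, sⁱ)(x^k)` for `i ≤ k`, and `w k ∈ ∂r₂(x^k)`. The samples are independent with law
`P`, and each sample `s^k` is drawn independently of the past samples and of the iterates
`x⁰, ..., x^k` already computed. -/
structure IsRun {n : ℕ} {Ω : Type*} [MeasurableSpace Ω] {P : Measure Ω} (p : Program n P)
    (alg : Scheme) (a : ℕ → ℝ) {Ω' : Type*} [MeasurableSpace Ω'] (μ : Measure Ω')
    (x₀ : E n) (s : ℕ → Ω' → Ω) (x : ℕ → Ω' → E n)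
    (z : ℕ → ℕ → Ω' → E n) (w : ℕ → Ω' → E n) : Prop where
  sample_measurable : ∀ k, Measurable (s k)
  sample_law : ∀ k, μ.map (s k) = P
  sample_indep : iIndepFun s μ
  iterate_measurable : ∀ k, Measurable (x k)
  sample_fresh : ∀ k, Indep (MeasurableSpace.comap (s k) inferInstance) (history s x k) μ
  start_mem : p.r₁ x₀ ≠ ⊤
  start_eq : ∀ ω, x 0 ω = x₀
  z_mem : ∀ᵐ ω ∂μ, ∀ k i : ℕ, i ≤ k →
    z k i ω ∈ subdiff (ext fun v => p.h v (s i ω)) (x k ω)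
  w_mem : ∀ᵐ ω ∂μ, ∀ k : ℕ, w k ω ∈ subdiff p.r₂ (x k ω)
  step : ∀ᵐ ω ∂μ, ∀ k : ℕ,
    IsMinOn (fun v : E n =>
      ((p.firstComponent a (fun i => s i ω) k alg v : ℝ) : EReal) + p.r₁ v
        - ((inner ℝ (weightedAvg a k (fun i => z k i ω) + w k ω) v : ℝ) : EReal))
      Set.univ (x (k + 1) ω)

/-- `d_k = min_{1 ≤ i ≤ k} 𝔼 d(0, ∂G(xⁱ) + ∂r₁(xⁱ) - ∂H(xⁱ) - ∂r₂(xⁱ))`, where the distance to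
the empty set is `+∞`. -/
def criticalityGap {n : ℕ} {Ω : Type*} [MeasurableSpace Ω] {P : Measure Ω} (p : Program n P)
    {Ω' : Type*} [MeasurableSpace Ω'] (μ : Measure Ω') (x : ℕ → Ω' → E n) (k : ℕ) : ℝ≥0∞ :=
  ⨅ i ∈ Finset.Icc 1 k, ∫⁻ ω, Metric.infEDist 0 (p.residual (x i ω)) ∂μ

end SDC

end

/-! Let D_k(y) be the deviation at y of the weighted sample average from its mean, for the part of
the objective that is sampled (h for `sdca3`, h - g for `sdca4`). The value V_k = f(x^k) - D_k(x^k)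
is that of the objective in which the mean of this part is replaced by its average over s^0, ...,
s^k. While the averages are frozen, an iteration is an ordinary DC step, and strong convexity makes
it lose at least ρ/2 ‖x^{k+1} - x^k‖² for any finite ρ below the modulus. Updating the average then
adds α_{k+1}/A_{k+1} times two errors: D_k(x^{k+1}), and the mean minus the fresh sample, both at
x^{k+1}. This is `Trajectory.value_succ_le`.

The point x^{k+1} depends on the past samples, so the first error is controlled uniformly over a
ball. A net of mesh 1/β_k and Hoeffding's lemma give a dominating variable of mean O((1 + √ln
β_k)/β_k) (`exists_uniform_deviation_bound`), and the summability condition on the weights makes the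
weighted series of these variables converge almost surely. The second error has mean zero given the
past, because s^{k+1} is independent of the history that includes x^{k+1}; since ∑ (α_k/A_k)² < ∞
(`AdmissibleWeights.summable_relWeight_sq`), its partial sums form an L²-bounded martingale and
converge (`ae_tendsto_sum_centered`). Hence V_k, which is bounded below, decreases up to a
convergent error series, and `tendsto_and_summable_of_le` gives its convergence and the summability
of the squared steps. The uniform strong law D_k → 0 transfers convergence from V_k to f(x^k).

For criticality, the steps tend to zero, so x^k and x^{k+1} share their limit along a subsequence.
The averaged subgradients are bounded and so is w^k on the outcomes considered; the subgradient and
optimality inequalities pass to the limit by locally uniform convergence and lower semicontinuity,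
and the Moreau–Rockafellar sum rule splits the limit inequality (`Trajectory.isCritical`).

For the rate, the optimality condition at x^{k+1} yields an element of D(x^{k+1}) whose norm is at
most a gradient deviation plus L ‖x^{k+1} - x^k‖ (`exists_residual_bound`). Expected squared steps
have bounded sums, so averaging the squared bounds over k iterations controls the smallest expected
distance. -/

noncomputable section

namespace SDC

/-! ### Subgradients, the sum rule, and equi-Lipschitz families of convex functions. -/

section ConvexAnalysis

variable {n : ℕ}

/-- On a function that avoids `-∞`, subgradients are tested at finite values only. -/
lemma mem_subdiff_iff {φ : E n → EReal} (hφ : ∀ x, φ x ≠ ⊥) {x v : E n} :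
    v ∈ subdiff φ x ↔ φ x ≠ ⊤ ∧
      ∀ y, φ y ≠ ⊤ → (φ x).toReal + inner ℝ v (y - x) ≤ (φ y).toReal := by
  unfold subdiff
  simp only [Set.mem_ofPred_eq]
  refine and_congr_right fun hx => forall_congr' fun y => ?_
  by_cases hy : φ y = ⊤
  · simp [hy]
  · simp only [ne_eq, hy, not_false_eq_true, forall_true_left]
    conv_lhs => rw [← EReal.coe_toReal hx (hφ x), ← EReal.coe_toReal hy (hφ y)]
    norm_cast

lemma mem_subdiff_ext_iff {φ : E n → ℝ} {x v : E n} :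
    v ∈ subdiff (ext φ) x ↔ ∀ y, φ x + inner ℝ v (y - x) ≤ φ y := by
  rw [mem_subdiff_iff (φ := ext φ) (fun x => EReal.coe_ne_bot _)]
  simp [ext]

lemma RhoConvex.toReal_le {φ : E n → EReal} {ρ : ℝ≥0} (h : RhoConvex ρ φ) (hφ : ∀ x, φ x ≠ ⊥)
    {x y : E n} (hx : φ x ≠ ⊤) (hy : φ y ≠ ⊤) {t : ℝ} (h0 : 0 ≤ t) (h1 : t ≤ 1) :
    φ (t • x + (1 - t) • y) ≠ ⊤ ∧
      (φ (t • x + (1 - t) • y)).toReal ≤ t * (φ x).toReal + (1 - t) * (φ y).toReal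
        - (ρ : ℝ) / 2 * t * (1 - t) * ‖x - y‖ ^ 2 := by
  have := h x y t h0 h1
  rw [← EReal.coe_toReal hx (hφ x), ← EReal.coe_toReal hy (hφ y)] at this
  have h2 : φ (t • x + (1 - t) • y) ≤ ((t * (φ x).toReal + (1 - t) * (φ y).toReal
        - (ρ : ℝ) / 2 * t * (1 - t) * ‖x - y‖ ^ 2 : ℝ) : EReal) := by
    refine this.trans (le_of_eq ?_)
    norm_cast
  have h3 : φ (t • x + (1 - t) • y) ≠ ⊤ := fun h4 => by
    rw [h4] at h2; exact EReal.coe_ne_top _ (top_le_iff.1 h2)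
  refine ⟨h3, ?_⟩
  rw [← EReal.coe_toReal h3 (hφ _)] at h2
  exact_mod_cast h2

lemma rhoConvex_zero_ext {φ : E n → ℝ} (h : ConvexOn ℝ Set.univ φ) : RhoConvex 0 (ext φ) := by
  intro x y t h0 h1
  have := h.2 (Set.mem_univ x) (Set.mem_univ y) h0 (sub_nonneg.2 h1) (by ring)
  simp only [smul_eq_mul] at this
  simp only [ext, NNReal.coe_zero, zero_div, zero_mul]
  norm_cast
  simpa using this

lemma RhoConvex.anti {φ : E n → EReal} {ρ ρ' : ℝ≥0} (h : RhoConvex ρ φ) (hle : ρ' ≤ ρ) :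
    RhoConvex ρ' φ := by
  intro x y t h0 h1
  refine (h x y t h0 h1).trans (EReal.sub_le_sub le_rfl ?_)
  have h2 : (ρ' : ℝ) ≤ ρ := by exact_mod_cast hle
  have h3 := sub_nonneg.2 h1
  exact_mod_cast (by gcongr)

lemma exists_rhoConvex_of_lt {φ : E n → EReal} {ρ : ℝ≥0}
    (h : (ρ : ℝ≥0∞) < strongConvexityModulus φ) : RhoConvex ρ φ := by
  unfold strongConvexityModulus at h
  simp only [lt_iSup_iff] at h
  obtain ⟨ρ', h1, h2⟩ := h
  exact h1.anti (by exact_mod_cast h2.le)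

/-- The strengthened subgradient inequality of a `ρ`-convex function. -/
lemma RhoConvex.subgradient_le {φ : E n → EReal} {ρ : ℝ≥0} (h : RhoConvex ρ φ)
    (hφ : ∀ x, φ x ≠ ⊥) {x y v : E n} (hv : v ∈ subdiff φ x) (hy : φ y ≠ ⊤) :
    (φ x).toReal + inner ℝ v (y - x) + (ρ : ℝ) / 2 * ‖y - x‖ ^ 2 ≤ (φ y).toReal := by
  obtain ⟨hx, hv⟩ := (mem_subdiff_iff hφ).1 hv
  have key : ∀ t ∈ Set.Ioo (0 : ℝ) 1,
      (φ x).toReal + inner ℝ v (y - x) + (ρ : ℝ) / 2 * ‖y - x‖ ^ 2 * (1 - t)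
        ≤ (φ y).toReal := by
    rintro t ⟨h0, h1⟩
    obtain ⟨h2, h3⟩ := h.toReal_le hφ hy hx h0.le h1.le
    have h4 := hv _ h2
    have h5 : t • y + (1 - t) • x - x = t • (y - x) := by module
    rw [h5, inner_smul_right] at h4
    have h6 : 0 ≤ t * ((φ y).toReal - ((φ x).toReal + inner ℝ v (y - x)
        + (ρ : ℝ) / 2 * ‖y - x‖ ^ 2 * (1 - t))) := by nlinarith
    have := nonneg_of_mul_nonneg_right h6 h0
    linarith
  have lim : Tendsto (fun t : ℝ => (φ x).toReal + inner ℝ v (y - x)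
      + (ρ : ℝ) / 2 * ‖y - x‖ ^ 2 * (1 - t)) (𝓝[>] 0)
      (𝓝 ((φ x).toReal + inner ℝ v (y - x) + (ρ : ℝ) / 2 * ‖y - x‖ ^ 2)) := by
    refine Tendsto.mono_left ?_ nhdsWithin_le_nhds
    refine Continuous.tendsto' (by fun_prop) _ _ (by simp)
  refine le_of_tendsto lim ?_
  filter_upwards [Ioo_mem_nhdsGT (zero_lt_one' ℝ)] with t ht using key t ht

/-- The sum rule of Moreau and Rockafellar, one function being finite and continuous. -/
lemma exists_subgradient_add {G : E n → ℝ} (hG : ConvexOn ℝ Set.univ G) (hGc : Continuous G)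
    {r : E n → EReal} (hr : ∀ x, r x ≠ ⊥) (hrc : RhoConvex 0 r) {x v : E n} (hx : r x ≠ ⊤)
    (hv : ∀ y, r y ≠ ⊤ → G x + (r x).toReal + inner ℝ v (y - x) ≤ G y + (r y).toReal) :
    ∃ u ∈ subdiff (ext G) x, v - u ∈ subdiff r x := by
  -- The open strict epigraph of G is separated from the hypograph of the concave function y ↦ G x +
  -- ⟨v, y - x⟩ - r y + r x. The hypothesis `hv` makes them disjoint, and they touch at (x, G x).
  -- The slope of the separating hyperplane is the required subgradient of G.
  let A : Set (E n × ℝ) := {q | G q.1 < q.2}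
  let B : Set (E n × ℝ) :=
    {q | r q.1 ≠ ⊤ ∧ q.2 ≤ G x + inner ℝ v (q.1 - x) - (r q.1).toReal + (r x).toReal}
  have hA : Convex ℝ A := by
    have := hG.convex_strict_epigraph
    simpa [A] using this
  have hAo : IsOpen A := isOpen_lt (by fun_prop) (by fun_prop)
  have hB : Convex ℝ B := by
    rintro ⟨y₁, t₁⟩ ⟨h1, h1'⟩ ⟨y₂, t₂⟩ ⟨h2, h2'⟩ b c hb hc hbc
    obtain rfl : c = 1 - b := by linarith
    obtain ⟨h3, h4⟩ := hrc.toReal_le hr h1 h2 hb (by linarith)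
    refine ⟨h3, ?_⟩
    simp only [Prod.smul_mk, Prod.mk_add_mk, smul_eq_mul] at *
    have h5 : b • y₁ + (1 - b) • y₂ - x = b • (y₁ - x) + (1 - b) • (y₂ - x) := by module
    rw [h5, inner_add_right, inner_smul_right, inner_smul_right]
    simp only [NNReal.coe_zero, zero_div, zero_mul, sub_zero] at h4
    nlinarith [mul_le_mul_of_nonneg_left h1' hb, mul_le_mul_of_nonneg_left h2' hc]
  have hAB : Disjoint A B := by
    rw [Set.disjoint_left]
    rintro ⟨y, t⟩ h1 ⟨h2, h3⟩
    simp only [A, Set.mem_ofPred_eq] at h1 h2 h3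
    linarith [hv y h2]
  obtain ⟨f, c, hfA, hfB⟩ := geometric_hahn_banach_open hA hAo hB hAB
  set τ : ℝ := f (0, 1) with hτ
  let ℓ : StrongDual ℝ (E n) := f.comp (ContinuousLinearMap.inl ℝ (E n) ℝ)
  have hf : ∀ y t, f (y, t) = ℓ y + τ * t := by
    intro y t
    have : ((y, t) : E n × ℝ) = (y, 0) + t • (0, 1) := by simp
    rw [this, map_add, map_smul]
    simp [ℓ, hτ, mul_comm]
  set ξ := (InnerProductSpace.toDual ℝ (E n)).symm ℓ
  have hξ : ∀ y, ℓ y = inner ℝ ξ y := fun y => by simp [ξ]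
  have hxB : c ≤ ℓ x + τ * G x := by
    rw [← hf]; exact hfB _ ⟨hx, by simp⟩
  have hA' : ∀ y t, G y < t → ℓ y + τ * t < c := fun y t h => by
    rw [← hf]; exact hfA _ h
  -- The hyperplane is not vertical: above x, the first set contains (x, G x + 1) while the second
  -- contains (x, G x).
  have hτneg : τ < 0 := by
    have := hA' x (G x + 1) (by linarith)
    linarith
  have hA'' : ∀ y, ℓ y + τ * G y ≤ c := by
    intro y
    have lim : Tendsto (fun e : ℝ => ℓ y + τ * (G y + e)) (𝓝[>] 0) (𝓝 (ℓ y + τ * G y)) := by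
      refine Tendsto.mono_left ?_ nhdsWithin_le_nhds
      exact Continuous.tendsto' (by fun_prop) _ _ (by simp)
    refine le_of_tendsto lim ?_
    filter_upwards [self_mem_nhdsWithin] with e he
    exact (hA' y _ (by simpa using he)).le
  have hinner : ∀ y, inner ℝ ((-τ)⁻¹ • ξ) (y - x) = (-τ)⁻¹ * (ℓ y - ℓ x) := by
    intro y
    rw [inner_smul_left, inner_sub_right, hξ, hξ]; simp
  have hτ' : 0 < -τ := by linarith
  refine ⟨(-τ)⁻¹ • ξ, mem_subdiff_ext_iff.2 fun y => ?_,
    (mem_subdiff_iff hr).2 ⟨hx, fun y hy => ?_⟩⟩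
  · have h1 : ℓ y - ℓ x ≤ (-τ) * (G y - G x) := by linarith [hA'' y]
    rw [hinner]
    have h2 := mul_le_mul_of_nonneg_left h1 (inv_nonneg.2 hτ'.le)
    rw [inv_mul_cancel_left₀ hτ'.ne'] at h2
    linarith
  · have h0 := hfB (y, G x + inner ℝ v (y - x) - (r y).toReal + (r x).toReal) ⟨hy, le_rfl⟩
    rw [hf] at h0
    have h1 : (-τ) * (inner ℝ v (y - x) - (r y).toReal + (r x).toReal) ≤ ℓ y - ℓ x := by
      linarith [hA'' x]
    rw [inner_sub_left, hinner]
    have h2 := mul_le_mul_of_nonneg_left h1 (inv_nonneg.2 hτ'.le)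
    rw [inv_mul_cancel_left₀ hτ'.ne'] at h2
    linarith

/-- Optimality in a subproblem, in terms of finite values. -/
lemma subproblem_optimality {G : E n → ℝ} {r : E n → EReal} (hr : ∀ x, r x ≠ ⊥) {ξ x : E n}
    (hmin : IsMinOn (fun v : E n => ((G v : ℝ) : EReal) + r v - ((inner ℝ ξ v : ℝ) : EReal))
      Set.univ x) {x' : E n} (hx' : r x' ≠ ⊤) :
    r x ≠ ⊤ ∧ ∀ y, r y ≠ ⊤ →
      G x + (r x).toReal + inner ℝ ξ (y - x) ≤ G y + (r y).toReal := by
  have hle : ∀ y, ((G x : ℝ) : EReal) + r x - ((inner ℝ ξ x : ℝ) : EReal)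
      ≤ ((G y : ℝ) : EReal) + r y - ((inner ℝ ξ y : ℝ) : EReal) := fun y => hmin (Set.mem_univ y)
  have hx : r x ≠ ⊤ := by
    intro h
    have := hle x'
    rw [h, ← EReal.coe_toReal hx' (hr x'), EReal.coe_add_top, EReal.top_sub_coe] at this
    have h2 := top_le_iff.1 this
    norm_cast at h2
  refine ⟨hx, fun y hy => ?_⟩
  have := hle y
  rw [← EReal.coe_toReal hx (hr x), ← EReal.coe_toReal hy (hr y)] at this
  norm_cast at this
  rw [inner_sub_right]
  linarith

/-- A subgradient at a point of differentiability is the gradient. -/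
lemma eq_gradient_of_mem_subdiff {φ : E n → EReal} (hφ : ∀ x, φ x ≠ ⊥) {x v : E n}
    (hv : v ∈ subdiff φ x) (hfin : ∀ᶠ y in 𝓝 x, φ y ≠ ⊤ ∧ φ y ≠ ⊥)
    (hd : DifferentiableAt ℝ (fun y => (φ y).toReal) x) :
    v = gradient (fun y => (φ y).toReal) x := by
  obtain ⟨hx, hv⟩ := (mem_subdiff_iff hφ).1 hv
  have hmin : IsLocalMin (fun y => (φ y).toReal - inner ℝ v y) x := by
    filter_upwards [hfin] with y hy
    have := hv y hy.1
    rw [inner_sub_right] at this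
    linarith
  have hd' := hd.hasGradientAt.hasFDerivAt.sub (innerSL ℝ v).hasFDerivAt (x := x)
  have h0 := hmin.hasFDerivAt_eq_zero hd'
  refine ext_inner_right ℝ fun y => ?_
  have : inner ℝ (gradient (fun y => (φ y).toReal) x) y - inner ℝ v y = 0 :=
    congrArg (fun f : StrongDual ℝ (E n) => f y) h0
  linarith

lemma hasDerivAt_comp_line {φ : E n → ℝ} {x : E n} (hd : DifferentiableAt ℝ φ x) (d : E n) :
    HasDerivAt (fun t : ℝ => φ (x + t • d)) (inner ℝ (gradient φ x) d) 0 := by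
  have h2 : HasDerivAt (fun t : ℝ => x + t • d) d 0 := by
    simpa using ((hasDerivAt_id (0 : ℝ)).smul_const d).const_add x
  have h3 : HasFDerivAt φ (InnerProductSpace.toDual ℝ (E n) (gradient φ x))
      (x + (0 : ℝ) • d) := by simpa using hd.hasGradientAt.hasFDerivAt
  exact h3.comp_hasDerivAt (0 : ℝ) h2

/-- The gradient inequality for convex functions. -/
lemma gradient_mem_subdiff {φ : E n → ℝ} (hc : ConvexOn ℝ Set.univ φ) {x : E n}
    (hd : DifferentiableAt ℝ φ x) : gradient φ x ∈ subdiff (ext φ) x := by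
  refine mem_subdiff_ext_iff.2 fun y => ?_
  have h1 := hasDerivAt_comp_line hd (y - x)
  have h2 := h1.tendsto_slope_zero_right
  have h3 : inner ℝ (gradient φ x) (y - x) ≤ φ y - φ x := by
    refine le_of_tendsto h2 ?_
    filter_upwards [Ioo_mem_nhdsGT (zero_lt_one' ℝ)] with t ht
    have h4 := hc.2 (Set.mem_univ y) (Set.mem_univ x) ht.1.le (sub_nonneg.2 ht.2.le) (by ring)
    have h5 : t • y + (1 - t) • x = x + t • (y - x) := by module
    rw [h5] at h4
    simp only [smul_eq_mul, zero_add, zero_smul, add_zero] at h4 ⊢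
    rw [inv_mul_le_iff₀ ht.1]
    linarith
  linarith

/-- A family that is bounded at each point and equicontinuous is bounded on compact sets. -/
lemma BoundedEquicontinuous.exists_bound {Ω : Type*} {u : E n → Ω → ℝ}
    (hu : BoundedEquicontinuous u) {C : Set (E n)} (hC : IsCompact C) :
    ∃ M : ℝ, 0 < M ∧ ∀ x ∈ C, ∀ s, |u x s| ≤ M := by
  refine hC.induction_on (p := fun C => ∃ M : ℝ, 0 < M ∧ ∀ x ∈ C, ∀ s, |u x s| ≤ M)
    ⟨1, one_pos, by simp⟩ (fun s t hst ⟨M, h0, h⟩ => ⟨M, h0, fun x hx => h x (hst hx)⟩) ?_ ?_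
  · rintro s t ⟨M, h0, h⟩ ⟨M', h0', h'⟩
    refine ⟨M + M', by linarith, ?_⟩
    rintro x (hx | hx) ω
    · linarith [h x hx ω]
    · linarith [h' x hx ω]
  · intro x _
    obtain ⟨M, hM⟩ := hu.1 x
    obtain ⟨δ, hδ, h⟩ := hu.2 x 1 one_pos
    refine ⟨Metric.ball x δ, mem_nhdsWithin_of_mem_nhds (Metric.ball_mem_nhds x hδ),
      |M| + 1, by positivity, fun y hy s => ?_⟩
    have h1 := h y hy s
    have h2 := abs_add_le (u x s) (u y s - u x s)
    have h3 := hM s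
    have h4 := le_abs_self M
    rw [add_sub_cancel] at h2
    linarith

/-- Convex functions with a common bound on a ball are equi-Lipschitz on a smaller ball. -/
lemma BoundedEquicontinuous.exists_lipschitz {Ω : Type*} {u : E n → Ω → ℝ}
    (hu : BoundedEquicontinuous u) (hc : ∀ s, ConvexOn ℝ Set.univ fun x => u x s) (R : ℝ) :
    ∃ Λ : ℝ, 0 < Λ ∧ ∀ x ∈ Metric.closedBall (0 : E n) R, ∀ y ∈ Metric.closedBall (0 : E n) R,
      ∀ s, |u x s - u y s| ≤ Λ * ‖x - y‖ := by
  -- A convex function bounded by M on a ball is Lipschitz with constant 2M / 1 on the ball of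
  -- radius smaller by 1. Starting from R + 2 leaves an open ball of radius R + 1, which contains
  -- the closed ball of radius R.
  obtain ⟨M, hM0, hM⟩ := hu.exists_bound (isCompact_closedBall (0 : E n) (R + 2))
  refine ⟨2 * M, by positivity, fun x hx y hy s => ?_⟩
  have h1 : LipschitzOnWith (2 * M / 1).toNNReal (fun x => u x s) (Metric.ball 0 (R + 2 - 1)) := by
    refine ((hc s).subset (Set.subset_univ _) (convex_ball _ _)).lipschitzOnWith_of_abs_le
      one_pos fun a ha => hM a ?_ s
    simpa using (by simpa using ha : ‖a‖ < R + 2).le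
  have hsub : Metric.closedBall (0 : E n) R ⊆ Metric.ball 0 (R + 2 - 1) :=
    Metric.closedBall_subset_ball (by linarith)
  have := h1.dist_le_mul x (hsub hx) y (hsub hy)
  rw [Real.dist_eq, dist_eq_norm, Real.coe_toNNReal _ (by positivity)] at this
  simpa using this

end ConvexAnalysis

/-! ### Weighted averages and their recursion. -/

section Weights

variable {a : ℕ → ℝ}

lemma weightSum_pos (ha : ∀ k, 0 < a k) (k : ℕ) : 0 < weightSum a k :=
  Finset.sum_pos (fun i _ => ha i) ⟨0, by simp⟩

lemma weightSum_succ (a : ℕ → ℝ) (k : ℕ) : weightSum a (k + 1) = weightSum a k + a (k + 1) :=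
  Finset.sum_range_succ _ _

lemma sum_sq_pos (ha : ∀ k, 0 < a k) (k : ℕ) : 0 < ∑ i ∈ Finset.range (k + 1), a i ^ 2 :=
  Finset.sum_pos (fun i _ => pow_pos (ha i) 2) ⟨0, by simp⟩

lemma beta_sq (ha : ∀ k, 0 < a k) (k : ℕ) :
    beta a k ^ 2 = weightSum a k ^ 2 / ∑ i ∈ Finset.range (k + 1), a i ^ 2 := by
  rw [beta, div_pow, Real.sq_sqrt (sum_sq_pos ha k).le]

lemma one_le_beta (ha : ∀ k, 0 < a k) (k : ℕ) : 1 ≤ beta a k := by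
  have h0 : 0 ≤ beta a k := div_nonneg (weightSum_pos ha k).le (Real.sqrt_nonneg _)
  rw [← one_le_sq_iff₀ h0, beta_sq ha, one_le_div (sum_sq_pos ha k)]
  exact Finset.sum_sq_le_sq_sum_of_nonneg fun i _ => (ha i).le

variable {V : Type*} [NormedAddCommGroup V] [NormedSpace ℝ V]

lemma norm_weightedAvg_le (ha : ∀ k, 0 < a k) {k : ℕ} {v : ℕ → V} {c : ℝ}
    (hv : ∀ i ≤ k, ‖v i‖ ≤ c) : ‖weightedAvg a k v‖ ≤ c := by
  have hA := weightSum_pos ha k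
  rw [weightedAvg, norm_smul, norm_inv, Real.norm_of_nonneg hA.le, inv_mul_le_iff₀ hA, weightSum,
    Finset.sum_mul]
  refine (norm_sum_le _ _).trans (Finset.sum_le_sum fun i hi => ?_)
  rw [norm_smul, Real.norm_of_nonneg (ha i).le]
  exact mul_le_mul_of_nonneg_left (hv i (by simpa [Nat.lt_succ_iff] using hi)) (ha i).le

lemma weightedAvg_sub (k : ℕ) (v v' : ℕ → V) :
    weightedAvg a k (fun i => v i - v' i) = weightedAvg a k v - weightedAvg a k v' := by
  simp [weightedAvg, smul_sub, Finset.sum_sub_distrib]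

lemma weightedAvg_const (ha : ∀ k, 0 < a k) (k : ℕ) (c : V) :
    weightedAvg a k (fun _ => c) = c := by
  have hA := weightSum_pos ha k
  rw [weightedAvg, ← Finset.sum_smul, smul_smul, ← weightSum, inv_mul_cancel₀ hA.ne', one_smul]

lemma weightedAvg_mono (ha : ∀ k, 0 < a k) {k : ℕ} {v v' : ℕ → ℝ}
    (h : ∀ i ≤ k, v i ≤ v' i) : weightedAvg a k v ≤ weightedAvg a k v' := by
  have hA := weightSum_pos ha k
  refine mul_le_mul_of_nonneg_left (Finset.sum_le_sum fun i hi => ?_) (inv_nonneg.2 hA.le)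
  exact mul_le_mul_of_nonneg_left (h i (by simpa [Nat.lt_succ_iff] using hi)) (ha i).le

lemma weightedAvg_add (k : ℕ) (v v' : ℕ → V) :
    weightedAvg a k (fun i => v i + v' i) = weightedAvg a k v + weightedAvg a k v' := by
  simp [weightedAvg, smul_add, Finset.sum_add_distrib]

/-- The recursion satisfied by weighted averages. -/
lemma weightedAvg_succ (ha : ∀ k, 0 < a k) (k : ℕ) (v : ℕ → ℝ) :
    weightedAvg a (k + 1) v =
      weightedAvg a k v + a (k + 1) / weightSum a (k + 1) * (v (k + 1) - weightedAvg a k v) := by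
  have h1 := weightSum_pos ha k
  have h2 := weightSum_pos ha (k + 1)
  have h3 := weightSum_succ a k
  simp only [weightedAvg, smul_eq_mul]
  rw [Finset.sum_range_succ]
  set S := ∑ i ∈ Finset.range (k + 1), a i * v i
  have h4 : a (k + 1) = weightSum a (k + 1) - weightSum a k := by linarith
  rw [h4]
  field_simp
  ring

end Weights

/-! ### Nets of polynomial size and the sub-Gaussian bound for weighted averages. -/

section Concentration

variable {n : ℕ}

/-- A bounded set of `ℝⁿ` has a `δ`-net of polynomial size. -/
lemma exists_net {C : Set (E n)} {R : ℝ} (hR : 0 ≤ R) (hC : C ⊆ Metric.closedBall 0 R) {δ : ℝ}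
    (hδ : 0 < δ) :
    ∃ T : Finset (E n), ↑T ⊆ C ∧ (∀ x ∈ C, ∃ y ∈ T, ‖x - y‖ ≤ δ) ∧
      (T.card : ℝ) ≤ (2 * R * (n + 1) / δ + 3) ^ n := by
  classical
  -- Points in a common cubic cell of side η are at distance at most √n η ≤ δ; the denominator n + 1
  -- also covers n = 0.
  set η : ℝ := δ / (n + 1) with hη
  have hη0 : 0 < η := by positivity
  let key : E n → (Fin n → ℤ) := fun x i => ⌊x i / η⌋
  set m : ℤ := ⌈R / η⌉
  have hm0 : 0 ≤ m := Int.ceil_nonneg (by positivity)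
  let K : Finset (Fin n → ℤ) := Fintype.piFinset fun _ => Finset.Icc (-m) m
  have hkey : ∀ x ∈ C, key x ∈ K := by
    intro x hx
    simp only [K, key, Fintype.mem_piFinset, Finset.mem_Icc]
    intro i
    have h1 : |x i| ≤ R := by
      have h2 : ‖x i‖ ≤ ‖x‖ := PiLp.norm_apply_le x i
      have h3 : ‖x‖ ≤ R := by simpa using hC hx
      exact h2.trans h3
    obtain ⟨h2, h3⟩ := abs_le.1 h1
    constructor
    · rw [Int.le_floor]
      have h4 := Int.le_ceil (R / η)
      have h5 : -(R / η) ≤ x i / η := by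
        rw [← neg_div]; gcongr
      push_cast
      linarith
    · have h4 : x i / η ≤ R / η := by gcongr
      have h5 : ((⌊x i / η⌋ : ℤ) : ℝ) ≤ m :=
        (Int.floor_le _).trans (h4.trans (Int.le_ceil _))
      exact_mod_cast h5
  -- One representative in C is kept for each occupied cell, so that the net lies inside C, where
  -- the bounds on the family are available.
  let rep := Function.invFunOn key C
  refine ⟨(K.filter (· ∈ key '' C)).image rep, ?_, ?_, ?_⟩
  · intro y hy
    simp only [Finset.coe_image, Finset.coe_filter, Set.mem_image] at hy
    obtain ⟨q, ⟨_, hq⟩, rfl⟩ := hy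
    exact Function.invFunOn_mem hq
  · intro x hx
    refine ⟨rep (key x), Finset.mem_image_of_mem _
      (Finset.mem_filter.2 ⟨hkey x hx, x, hx, rfl⟩), ?_⟩
    have h1 : key (rep (key x)) = key x := Function.invFunOn_eq ⟨x, hx, rfl⟩
    set y := rep (key x)
    have h2 : ∀ i, |x i - y i| ≤ η := by
      intro i
      have h3 := Int.abs_sub_lt_one_of_floor_eq_floor (congrFun h1 i)
      rw [← sub_div, abs_div, abs_of_pos hη0, div_lt_one hη0, abs_sub_comm] at h3
      exact h3.le
    have h3 : ‖x - y‖ ^ 2 ≤ δ ^ 2 := by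
      rw [EuclideanSpace.norm_sq_eq]
      calc ∑ i, ‖(x - y) i‖ ^ 2 ≤ ∑ _i : Fin n, η ^ 2 := by
            refine Finset.sum_le_sum fun i _ => ?_
            have := h2 i
            rw [Real.norm_eq_abs]
            exact pow_le_pow_left₀ (abs_nonneg _) this 2
        _ = n * η ^ 2 := by simp
        _ ≤ (n + 1) ^ 2 * η ^ 2 := by
            gcongr
            nlinarith [(Nat.cast_nonneg n : (0 : ℝ) ≤ n)]
        _ = δ ^ 2 := by rw [hη]; field_simp
    exact (pow_le_pow_iff_left₀ (norm_nonneg _) hδ.le two_ne_zero).1 h3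
  · have h1 : ((K.filter (· ∈ key '' C)).image rep).card ≤ K.card :=
      Finset.card_image_le.trans (Finset.card_filter_le _ _)
    have h2 : (K.card : ℝ) = (2 * m + 1 : ℝ) ^ n := by
      simp only [K, Fintype.card_piFinset, Int.card_Icc, Finset.prod_const, Finset.card_univ,
        Fintype.card_fin, Nat.cast_pow]
      congr 1
      have h3 : ((m + 1 - -m).toNat : ℤ) = 2 * m + 1 := by
        rw [Int.toNat_of_nonneg (by omega)]; ring
      exact_mod_cast congrArg (fun z : ℤ => (z : ℝ)) h3
    have h3 : (m : ℝ) ≤ R / η + 1 := (Int.ceil_lt_add_one _).le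
    have h4 : R / η = R * (n + 1) / δ := by rw [hη]; field_simp
    calc (((K.filter (· ∈ key '' C)).image rep).card : ℝ) ≤ K.card := by exact_mod_cast h1
      _ = (2 * m + 1 : ℝ) ^ n := h2
      _ ≤ _ := by
        have : (0 : ℝ) ≤ m := by exact_mod_cast hm0
        refine pow_le_pow_left₀ (by positivity) ?_ n
        rw [h4] at h3
        calc (2 * m + 1 : ℝ) ≤ 2 * (R * (n + 1) / δ + 1) + 1 := by linarith
          _ = _ := by ring

variable {Ω : Type*} [MeasurableSpace Ω] {P : Measure Ω}
  {Ω' : Type*} [MeasurableSpace Ω'] {μ : Measure Ω'} [IsProbabilityMeasure μ]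
  {a : ℕ → ℝ} {s : ℕ → Ω' → Ω}

/-- Hoeffding's lemma for weighted averages of bounded functions of the samples. -/
lemma hasSubgaussianMGF_weightedAvg (ha : ∀ k, 0 < a k) (hs : ∀ k, Measurable (s k))
    (hlaw : ∀ k, μ.map (s k) = P) (hind : iIndepFun s μ) {v : Ω → ℝ} (hv : AEMeasurable v P)
    {M : ℝ} (hM : ∀ t, |v t| ≤ M) (k : ℕ) :
    HasSubgaussianMGF (fun ω => weightedAvg a k (fun i => v (s i ω)) - ∫ t, v t ∂P)
      (M ^ 2 / beta a k ^ 2).toNNReal μ := by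
  have hA := weightSum_pos ha k
  have hM0 : 0 ≤ M := by
    obtain ⟨ω⟩ := nonempty_of_isProbabilityMeasure μ
    exact (abs_nonneg _).trans (hM (s 0 ω))
  have hvs : ∀ i, AEMeasurable (fun ω => v (s i ω)) μ := fun i =>
    (by rw [hlaw]; exact hv : AEMeasurable v (μ.map (s i))).comp_aemeasurable (hs i).aemeasurable
  have hint : ∀ i, ∫ ω, v (s i ω) ∂μ = ∫ t, v t ∂P := by
    intro i
    rw [← hlaw i, integral_map (hs i).aemeasurable]
    rw [hlaw]; exact hv.aestronglyMeasurable
  have h1 : ∀ i, HasSubgaussianMGF (fun ω => v (s i ω) - ∫ t, v t ∂P) (M ^ 2).toNNReal μ := by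
    intro i
    -- Hoeffding's parameter is the squared half-length of [-M, M], that is M². Summing it against
    -- (α_i / A_k)² gives M² / β_k².
    have := hasSubgaussianMGF_of_mem_Icc (a := -M) (b := M) (hvs i)
      (ae_of_all _ fun ω => abs_le.1 (hM (s i ω)))
    rw [hint] at this
    convert this using 1
    ext
    rw [Real.coe_toNNReal _ (by positivity)]
    push_cast
    rw [Real.norm_of_nonneg (by linarith)]
    ring
  have hind' : iIndepFun (fun i ω => a i / weightSum a k * (v (s i ω) - ∫ t, v t ∂P)) μ :=
    hind.comp₀ (fun i t => a i / weightSum a k * (v t - ∫ t, v t ∂P))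
      (fun i => (hs i).aemeasurable)
      (fun i => by rw [hlaw]; exact (hv.sub_const _).const_mul _)
  have h1' : ∀ i, HasSubgaussianMGF (fun ω => a i / weightSum a k * (v (s i ω) - ∫ t, v t ∂P))
      (Real.toNNReal ((a i / weightSum a k) ^ 2) * (M ^ 2).toNNReal) μ := by
    intro i
    rw [Real.toNNReal_of_nonneg (sq_nonneg (a i / weightSum a k))]
    exact (h1 i).const_mul _
  have h2 := HasSubgaussianMGF.sum_of_iIndepFun hind' (s := Finset.range (k + 1))
    (fun i _ => h1' i)
  have h3 : ∀ ω, ∑ i ∈ Finset.range (k + 1), a i / weightSum a k * (v (s i ω) - ∫ t, v t ∂P) =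
      weightedAvg a k (fun i => v (s i ω)) - ∫ t, v t ∂P := by
    intro ω
    conv_rhs => rw [← weightedAvg_const ha k (∫ t, v t ∂P), ← weightedAvg_sub]
    rw [weightedAvg, smul_eq_mul, Finset.mul_sum]
    refine Finset.sum_congr rfl fun i _ => ?_
    simp only [smul_eq_mul]; ring
  simp_rw [h3] at h2
  convert h2 using 1
  ext
  rw [Real.coe_toNNReal _ (by positivity), beta_sq ha]
  push_cast
  simp_rw [Real.coe_toNNReal _ (sq_nonneg _), div_pow]
  rw [← Finset.sum_mul, ← Finset.sum_div]
  have := sum_sq_pos ha k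
  field_simp

end Concentration

/-! ### Uniform deviation in mean, and the uniform strong law of large numbers. -/

section UniformDeviation

variable {n : ℕ} {Ω : Type*} [MeasurableSpace Ω] {P : Measure Ω}
  {Ω' : Type*} [MeasurableSpace Ω'] {μ : Measure Ω'}
  {a : ℕ → ℝ} {s : ℕ → Ω' → Ω} {u : E n → Ω → ℝ} {C : Set (E n)} {M Λ : ℝ}

/-- The rate `(1 + √(ln β_k)) / β_k`. -/
def rate (a : ℕ → ℝ) (k : ℕ) : ℝ := (1 + Real.sqrt (Real.log (beta a k))) / beta a k

lemma rate_pos (ha : ∀ k, 0 < a k) (k : ℕ) : 0 < rate a k :=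
  div_pos (by positivity) (zero_lt_one.trans_le (one_le_beta ha k))

lemma integrable_of_bound [IsProbabilityMeasure P] (hm : ∀ x ∈ C, AEMeasurable (u x) P)
    (hM : ∀ x ∈ C, ∀ t, |u x t| ≤ M) {x : E n} (hx : x ∈ C) : Integrable (u x) P :=
  Integrable.of_bound (hm x hx).aestronglyMeasurable M (ae_of_all _ (hM x hx))

/-- The deviation of the weighted averages from the mean is Lipschitz. -/
lemma abs_deviation_sub_le [IsProbabilityMeasure P] (ha : ∀ k, 0 < a k)
    (hm : ∀ x ∈ C, AEMeasurable (u x) P) (hM : ∀ x ∈ C, ∀ t, |u x t| ≤ M)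
    (hΛ : ∀ x ∈ C, ∀ y ∈ C, ∀ t, |u x t - u y t| ≤ Λ * ‖x - y‖) (σ : ℕ → Ω) (k : ℕ)
    {x y : E n} (hx : x ∈ C) (hy : y ∈ C) :
    |(weightedAvg a k (fun i => u x (σ i)) - ∫ t, u x t ∂P)
      - (weightedAvg a k (fun i => u y (σ i)) - ∫ t, u y t ∂P)| ≤ 2 * Λ * ‖x - y‖ := by
  have h1 : |weightedAvg a k (fun i => u x (σ i)) - weightedAvg a k (fun i => u y (σ i))|
      ≤ Λ * ‖x - y‖ := by
    rw [← weightedAvg_sub]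
    exact norm_weightedAvg_le (v := fun i => u x (σ i) - u y (σ i)) ha
      fun i _ => hΛ x hx y hy (σ i)
  have h2 : |∫ t, u x t ∂P - ∫ t, u y t ∂P| ≤ Λ * ‖x - y‖ := by
    rw [← integral_sub (integrable_of_bound hm hM hx) (integrable_of_bound hm hM hy)]
    have := norm_integral_le_of_norm_le_const (μ := P) (f := fun t => u x t - u y t)
      (ae_of_all _ (hΛ x hx y hy))
    simpa using this
  have h3 := abs_sub (weightedAvg a k (fun i => u x (σ i)) - weightedAvg a k (fun i => u y (σ i)))
    (∫ t, u x t ∂P - ∫ t, u y t ∂P)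
  calc _ = |(weightedAvg a k (fun i => u x (σ i)) - weightedAvg a k (fun i => u y (σ i)))
    - (∫ t, u x t ∂P - ∫ t, u y t ∂P)| := by congr 1; ring
    _ ≤ _ := by linarith

lemma sqrt_one_add_log_le {b : ℝ} (hb : 1 ≤ b) :
    Real.sqrt (1 + Real.log b) ≤ 1 + Real.sqrt (Real.log b) := by
  have := Real.log_nonneg hb
  refine Real.sqrt_le_iff.2 ⟨by positivity, ?_⟩
  nlinarith [Real.sq_sqrt this, Real.sqrt_nonneg (Real.log b)]

/-- The expected uniform deviation of the weighted averages of a bounded, equi-Lipschitz family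
from the mean, over a bounded set. -/
lemma exists_uniform_deviation_bound [IsProbabilityMeasure P] [IsProbabilityMeasure μ]
    (ha : ∀ k, 0 < a k) (hs : ∀ k, Measurable (s k))
    (hlaw : ∀ k, μ.map (s k) = P) (hind : iIndepFun s μ)
    {R : ℝ} (hR : 0 ≤ R) (hC : C ⊆ Metric.closedBall 0 R)
    (hm : ∀ x ∈ C, AEMeasurable (u x) P) (hM : ∀ x ∈ C, ∀ t, |u x t| ≤ M) (hΛ0 : 0 ≤ Λ)
    (hΛ : ∀ x ∈ C, ∀ y ∈ C, ∀ t, |u x t - u y t| ≤ Λ * ‖x - y‖) :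
    ∃ c : ℝ, ∃ Z : ℕ → Ω' → ℝ, 0 ≤ c ∧ ∀ k, Integrable (Z k) μ ∧
      (∀ ω, ∀ x ∈ C, |weightedAvg a k (fun i => u x (s i ω)) - ∫ t, u x t ∂P| ≤ Z k ω) ∧
      ∫ ω, Z k ω ∂μ ≤ c * rate a k := by
  set c₀ : ℝ := 2 * R * (n + 1) + 3 with hc₀
  have hc₀1 : 1 ≤ c₀ := by
    have : 0 ≤ 2 * R * (n + 1) := by positivity
    linarith
  -- Chosen so that log `B` ≤ c₁ (1 + log b) below: the terms account for log 2, for the two factors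
  -- of the net size (c₀ b)^n, and for the exponential moment.
  set c₁ : ℝ := 1 + n * Real.log c₀ + n + M ^ 2 / 2 with hc₁
  have hlc₀ := Real.log_nonneg hc₀1
  have hc₁0 : 0 ≤ c₁ := by positivity
  suffices h : ∀ k, ∃ Z : Ω' → ℝ, Integrable Z μ ∧
      (∀ ω, ∀ x ∈ C, |weightedAvg a k (fun i => u x (s i ω)) - ∫ t, u x t ∂P| ≤ Z ω) ∧
      ∫ ω, Z ω ∂μ ≤ (c₁ + 2 * Λ) * rate a k by
    choose Z hZ using h
    exact ⟨c₁ + 2 * Λ, Z, by positivity, hZ⟩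
  intro k
  set b := beta a k with hb
  have hb1 : 1 ≤ b := one_le_beta ha k
  have hb0 : 0 < b := zero_lt_one.trans_le hb1
  have hlb := Real.log_nonneg hb1
  obtain ⟨T, hTC, hT, hcard⟩ := exists_net hR hC (δ := b⁻¹) (inv_pos.2 hb0)
  set L := 1 + Real.log b with hL
  have hL1 : 1 ≤ L := by linarith
  -- With this parameter the exponential moment exp(lam² M² / (2b²)) and the net size have
  -- logarithms of the same order L, and dividing by lam leaves √L / b.
  set lam := b * Real.sqrt L with hlam
  have hsL : 1 ≤ Real.sqrt L := Real.one_le_sqrt.2 hL1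
  have hlam0 : 0 < lam := by positivity
  set N : ℝ := (c₀ * b) ^ n with hN
  have hN0 : 0 < N := by positivity
  have hcard' : (T.card : ℝ) ≤ N := by
    refine hcard.trans (pow_le_pow_left₀ (by positivity) ?_ n)
    rw [div_inv_eq_mul, hc₀]
    linarith
  set B : ℝ := 2 * N * Real.exp (M ^ 2 * L / 2) with hB
  have hB0 : 0 < B := by positivity
  let Y : E n → Ω' → ℝ := fun x ω => weightedAvg a k (fun i => u x (s i ω)) - ∫ t, u x t ∂P
  have hsub : ∀ x ∈ T, HasSubgaussianMGF (Y x) (M ^ 2 / b ^ 2).toNNReal μ := fun x hx =>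
    hasSubgaussianMGF_weightedAvg ha hs hlaw hind (hm x (hTC hx)) (hM x (hTC hx)) k
  have hexp : ∀ x ∈ T, ∀ l : ℝ, l ^ 2 = lam ^ 2 →
      ∫ ω, Real.exp (l * Y x ω) ∂μ ≤ Real.exp (M ^ 2 * L / 2) := by
    intro x hx l hl
    have h1 := (hsub x hx).mgf_le l
    rw [mgf, Real.coe_toNNReal _ (by positivity), hl, hlam, mul_pow, Real.sq_sqrt (by linarith)]
      at h1
    refine h1.trans (le_of_eq ?_)
    congr 1
    field_simp
  let S : Ω' → ℝ := fun ω => ∑ x ∈ T, (Real.exp (lam * Y x ω) + Real.exp (-lam * Y x ω))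
  have hSi : Integrable S μ := integrable_finsetSum _ fun x hx =>
    ((hsub x hx).integrable_exp_mul lam).add ((hsub x hx).integrable_exp_mul (-lam))
  have hSB : ∫ ω, S ω ∂μ ≤ B := by
    calc ∫ ω, S ω ∂μ = ∑ x ∈ T, ∫ ω, (Real.exp (lam * Y x ω) + Real.exp (-lam * Y x ω)) ∂μ :=
          integral_finsetSum _ fun x hx =>
            ((hsub x hx).integrable_exp_mul lam).add ((hsub x hx).integrable_exp_mul (-lam))
      _ ≤ ∑ _x ∈ T, (Real.exp (M ^ 2 * L / 2) + Real.exp (M ^ 2 * L / 2)) := by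
          refine Finset.sum_le_sum fun x hx => ?_
          rw [integral_add ((hsub x hx).integrable_exp_mul lam)
            ((hsub x hx).integrable_exp_mul (-lam))]
          exact add_le_add (hexp x hx lam rfl) (hexp x hx (-lam) (by ring))
      _ = T.card * (2 * Real.exp (M ^ 2 * L / 2)) := by
          rw [Finset.sum_const, nsmul_eq_mul]; ring
      _ ≤ N * (2 * Real.exp (M ^ 2 * L / 2)) := by gcongr
      _ = B := by rw [hB]; ring
  -- This explicit variable dominates the supremum over C, whose measurability is then never needed.
  -- The first term bounds the deviation on the net, the second the passage from the net to C.
  refine ⟨fun ω => (S ω / B - 1 + Real.log B) / lam + 2 * Λ * b⁻¹, ?_, ?_, ?_⟩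
  · exact ((((hSi.div_const B).sub (integrable_const 1)).add (integrable_const _)).div_const
      lam).add (integrable_const _)
  · intro ω x hx
    obtain ⟨y, hy, hxy⟩ := hT x hx
    have h1 := abs_deviation_sub_le ha hm hM hΛ (fun i => s i ω) k hx (hTC hy)
    have h2 : 2 * Λ * ‖x - y‖ ≤ 2 * Λ * b⁻¹ := by gcongr
    have h3 : |Y y ω| ≤ (S ω / B - 1 + Real.log B) / lam := by
      have h4 : Real.exp (lam * |Y y ω|) ≤ S ω := by
        have h5 : Real.exp (lam * |Y y ω|) ≤
            Real.exp (lam * Y y ω) + Real.exp (-lam * Y y ω) := by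
          rcases abs_cases (Y y ω) with ⟨h, _⟩ | ⟨h, _⟩ <;> rw [h]
          · linarith [Real.exp_pos (-lam * Y y ω)]
          · rw [mul_neg, ← neg_mul]; linarith [Real.exp_pos (lam * Y y ω)]
        exact h5.trans (Finset.single_le_sum
          (f := fun x => Real.exp (lam * Y x ω) + Real.exp (-lam * Y x ω))
          (fun x _ => by positivity) hy)
      -- The inequality t + 1 ≤ e^t at t = lam |Y| - log B replaces the logarithm of the exponential
      -- sum by a linear function of it, so the mean follows from the mean of S without Jensen's
      -- inequality.
      have h6 := Real.add_one_le_exp (lam * |Y y ω| - Real.log B)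
      rw [Real.exp_sub, Real.exp_log hB0] at h6
      have h7 : Real.exp (lam * |Y y ω|) / B ≤ S ω / B := by gcongr
      rw [le_div_iff₀ hlam0]
      linarith
    have h8 := abs_sub_abs_le_abs_sub (Y x ω) (Y y ω)
    change |Y x ω - Y y ω| ≤ _ at h1
    change |Y x ω| ≤ _
    linarith
  · have h1 : ∫ ω, ((S ω / B - 1 + Real.log B) / lam + 2 * Λ * b⁻¹) ∂μ
        = ((∫ ω, S ω ∂μ) / B - 1 + Real.log B) / lam + 2 * Λ * b⁻¹ := by
      have h2 : ∀ t : ℝ, (t / B - 1 + Real.log B) / lam + 2 * Λ * b⁻¹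
          = (B * lam)⁻¹ * t + ((Real.log B - 1) / lam + 2 * Λ * b⁻¹) := fun t => by
        field_simp; ring
      simp_rw [h2]
      rw [integral_add (hSi.const_mul _) (integrable_const _), integral_const_mul]
      simp
    rw [h1]
    have h2 : (∫ ω, S ω ∂μ) / B ≤ 1 := by rw [div_le_one hB0]; exact hSB
    have h3 : Real.log B ≤ c₁ * L := by
      rw [hB, Real.log_mul (by positivity) (by positivity), Real.log_mul two_ne_zero hN0.ne',
        Real.log_exp, hN, Real.log_pow, Real.log_mul (by positivity) hb0.ne', hc₁]
      have h4 : Real.log 2 ≤ 1 := by linarith [Real.log_two_lt_d9]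
      have h5 : n * Real.log c₀ ≤ n * Real.log c₀ * L :=
        le_mul_of_one_le_right (by positivity) hL1
      have h6 : (n : ℝ) * Real.log b ≤ n * L := by gcongr; linarith
      nlinarith
    have h4 : ((∫ ω, S ω ∂μ) / B - 1 + Real.log B) / lam ≤ c₁ * L / lam := by
      gcongr; linarith
    have h5 : c₁ * L / lam = c₁ * (Real.sqrt L / b) := by
      rw [hlam]
      have h6 : L = Real.sqrt L * Real.sqrt L := (Real.mul_self_sqrt (by linarith)).symm
      have h7 : Real.sqrt L ≠ 0 := by positivity
      rw [div_eq_iff (by positivity)]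
      field_simp
      nlinarith
    have h6 : Real.sqrt L / b ≤ rate a k := by
      unfold rate
      gcongr
      exact sqrt_one_add_log_le hb1
    have h7 : b⁻¹ ≤ rate a k := by
      unfold rate
      rw [inv_eq_one_div]
      gcongr
      linarith [Real.sqrt_nonneg (Real.log (beta a k))]
    calc _ ≤ c₁ * (Real.sqrt L / b) + 2 * Λ * b⁻¹ := by linarith
      _ ≤ c₁ * rate a k + 2 * Λ * rate a k := by gcongr
      _ = _ := by ring

/-- Supplies the Borel–Cantelli condition for every γ > 0: with t = k^γ, the bound e^{-κt} =
o(t^{-2/γ}) is a comparison with k^{-2}. -/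
lemma summable_exp_neg_rpow {κ γ : ℝ} (hκ : 0 < κ) (hγ : 0 < γ) :
    Summable fun k : ℕ => Real.exp (-κ * (k : ℝ) ^ γ) := by
  have h1 : (fun x : ℝ => Real.exp (-κ * x)) =o[atTop] fun x : ℝ => x ^ (-(2 / γ)) :=
    isLittleO_exp_neg_mul_rpow_atTop hκ _
  have h2 : Tendsto (fun k : ℕ => (k : ℝ) ^ γ) atTop atTop :=
    (tendsto_rpow_atTop hγ).comp tendsto_natCast_atTop_atTop
  have h3 := (h1.comp_tendsto h2).isBigO
  refine summable_of_isBigO_nat (g := fun k : ℕ => ((k : ℝ) ^ (2 : ℝ))⁻¹)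
    (Real.summable_nat_rpow_inv.2 (by norm_num)) (h3.congr_right fun k => ?_)
  simp only [Function.comp]
  rw [← Real.rpow_mul (Nat.cast_nonneg k), ← Real.rpow_neg (Nat.cast_nonneg k)]
  congr 1
  field_simp

/-- The strong law of large numbers for weighted averages of a bounded function. -/
lemma ae_tendsto_deviation [IsProbabilityMeasure μ] (ha : AdmissibleWeights a)
    (hs : ∀ k, Measurable (s k))
    (hlaw : ∀ k, μ.map (s k) = P) (hind : iIndepFun s μ) {v : Ω → ℝ} (hv : AEMeasurable v P)
    (hM : ∀ t, |v t| ≤ M) :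
    ∀ᵐ ω ∂μ,
      Tendsto (fun k => weightedAvg a k (fun i => v (s i ω)) - ∫ t, v t ∂P) atTop (𝓝 0) := by
  obtain ⟨N, γ, hN, hγ, hdec, -⟩ := ha.decay
  let Y : ℕ → Ω' → ℝ := fun k ω => weightedAvg a k (fun i => v (s i ω)) - ∫ t, v t ∂P
  have hM' : ∀ t, |v t| ≤ |M| + 1 := fun t => (hM t).trans (by linarith [le_abs_self M])
  set M' := |M| + 1
  have hM'0 : 0 < M' := by positivity
  have hsub : ∀ k, HasSubgaussianMGF (Y k) (M' ^ 2 / beta a k ^ 2).toNNReal μ := fun k =>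
    hasSubgaussianMGF_weightedAvg ha.pos hs hlaw hind hv hM' k
  -- Borel–Cantelli at the levels 1/(m + 1): the decay condition reads 1/β_k² ≤ N/k^γ, so the
  -- sub-Gaussian tails are at most 2 exp(-κ k^γ). The series starts at index 1, where that
  -- condition begins.
  have key : ∀ m : ℕ, ∀ᵐ ω ∂μ, ∀ᶠ k in atTop, |Y k ω| < 1 / ((m : ℝ) + 1) := by
    intro m
    set ε : ℝ := 1 / ((m : ℝ) + 1)
    have hε : 0 < ε := by positivity
    set κ : ℝ := ε ^ 2 / (2 * (M' ^ 2 * N))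
    have hκ : 0 < κ := by positivity
    have hbound : ∀ k : ℕ, 1 ≤ k →
        Real.exp (-ε ^ 2 / (2 * ((M' ^ 2 / beta a k ^ 2).toNNReal : ℝ)))
          ≤ Real.exp (-κ * (k : ℝ) ^ γ) := by
      intro k hk
      have h0 : (0 : ℝ) < (k : ℝ) ^ γ := Real.rpow_pos_of_pos (by exact_mod_cast hk) γ
      have hbpos : 0 < beta a k := zero_lt_one.trans_le (one_le_beta ha.pos k)
      rw [Real.coe_toNNReal _ (by positivity), Real.exp_le_exp, neg_div, neg_mul, neg_le_neg_iff]
      have h1 := hdec k hk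
      have h2 : (∑ i ∈ Finset.range (k + 1), a i ^ 2) / weightSum a k ^ 2 = 1 / beta a k ^ 2 := by
        rw [beta_sq ha.pos, one_div_div]
      rw [h2] at h1
      calc κ * (k : ℝ) ^ γ = ε ^ 2 / (2 * (M' ^ 2 * (N / (k : ℝ) ^ γ))) := by
            simp only [κ]; field_simp
        _ ≤ ε ^ 2 / (2 * (M' ^ 2 * (1 / beta a k ^ 2))) := by gcongr
        _ = _ := by rw [mul_one_div]
    have htail : ∀ k : ℕ, 1 ≤ k →
        μ {ω | ε ≤ |Y k ω|} ≤ ENNReal.ofReal (2 * Real.exp (-κ * (k : ℝ) ^ γ)) := by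
      intro k hk
      have h1 := (hsub k).measure_ge_le hε.le
      have h2 := (hsub k).neg.measure_ge_le hε.le
      have h3 := hbound k hk
      have h4 : {ω | ε ≤ |Y k ω|} ⊆ {ω | ε ≤ Y k ω} ∪ {ω | ε ≤ (-Y k) ω} := by
        intro ω hω
        simp only [Set.mem_union, Set.mem_ofPred_eq] at hω ⊢
        exact le_abs.1 hω
      have h5 : μ.real {ω | ε ≤ |Y k ω|} ≤ 2 * Real.exp (-κ * (k : ℝ) ^ γ) :=
        (measureReal_mono h4).trans ((measureReal_union_le _ _).trans (by linarith))
      rw [← ofReal_measureReal]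
      exact ENNReal.ofReal_le_ofReal h5
    have hsum : ∑' k : ℕ, μ {ω | ε ≤ |Y (k + 1) ω|} ≠ ∞ := by
      refine ne_top_of_le_ne_top ?_ (ENNReal.tsum_le_tsum fun k => htail (k + 1) (by omega))
      have h1 := ((summable_nat_add_iff 1).2 (summable_exp_neg_rpow hκ hγ)).mul_left 2
      exact h1.tsum_ofReal_ne_top
    filter_upwards [ae_eventually_notMem hsum] with ω hω
    rw [← map_add_atTop_eq_nat 1, eventually_map]
    filter_upwards [hω] with k hk
    simpa using hk
  filter_upwards [ae_all_iff.2 key] with ω hω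
  rw [Metric.tendsto_nhds]
  intro ε hε
  obtain ⟨m, hm⟩ := exists_nat_one_div_lt hε
  filter_upwards [hω m] with k hk
  rw [Real.dist_0_eq_abs]
  exact hk.trans hm

/-- The uniform strong law of large numbers over a compact set. -/
lemma ae_uniform_deviation [IsProbabilityMeasure P] [IsProbabilityMeasure μ]
    (ha : AdmissibleWeights a) (hs : ∀ k, Measurable (s k))
    (hlaw : ∀ k, μ.map (s k) = P) (hind : iIndepFun s μ)
    {R : ℝ} (hR : 0 ≤ R) (hC : C ⊆ Metric.closedBall 0 R)
    (hm : ∀ x ∈ C, AEMeasurable (u x) P) (hM : ∀ x ∈ C, ∀ t, |u x t| ≤ M) (hΛ0 : 0 ≤ Λ)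
    (hΛ : ∀ x ∈ C, ∀ y ∈ C, ∀ t, |u x t - u y t| ≤ Λ * ‖x - y‖) :
    ∀ᵐ ω ∂μ, ∀ ε > 0, ∀ᶠ k in atTop, ∀ x ∈ C,
      |weightedAvg a k (fun i => u x (s i ω)) - ∫ t, u x t ∂P| ≤ ε := by
  have hnet := fun m : ℕ => exists_net hR hC (δ := 1 / ((m : ℝ) + 1)) (by positivity)
  choose T hTC hT _ using hnet
  have h1 : ∀ᵐ ω ∂μ, ∀ m, ∀ y ∈ T m, Tendsto
      (fun k => weightedAvg a k (fun i => u y (s i ω)) - ∫ t, u y t ∂P) atTop (𝓝 0) := by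
    refine ae_all_iff.2 fun m => (ae_ball_iff (T m).countable_toSet).2 fun y hy => ?_
    exact ae_tendsto_deviation ha hs hlaw hind (hm y (hTC m hy)) (hM y (hTC m hy))
  filter_upwards [h1] with ω hω ε hε
  obtain ⟨m, hm'⟩ := exists_nat_one_div_lt (show 0 < ε / (2 * (2 * Λ + 1)) by positivity)
  have h2 : ∀ᶠ k in atTop, ∀ y ∈ T m,
      |weightedAvg a k (fun i => u y (s i ω)) - ∫ t, u y t ∂P| < ε / 2 := by
    rw [Filter.eventually_all_finset]
    intro y hy
    have := (hω m y hy).eventually (Metric.ball_mem_nhds 0 (half_pos hε))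
    filter_upwards [this] with k hk
    simpa using hk
  filter_upwards [h2] with k hk x hx
  obtain ⟨y, hy, hxy⟩ := hT m x hx
  have h3 := abs_deviation_sub_le ha.pos hm hM hΛ (fun i => s i ω) k hx (hTC m hy)
  have h4 := hk y hy
  have h5 : 2 * Λ * ‖x - y‖ ≤ ε / 2 := by
    calc 2 * Λ * ‖x - y‖ ≤ (2 * Λ + 1) * (ε / (2 * (2 * Λ + 1))) := by
          gcongr
          · linarith
          · exact hxy.trans hm'.le
      _ = ε / 2 := by field_simp
  have h6 := abs_sub_abs_le_abs_sub (weightedAvg a k (fun i => u x (s i ω)) - ∫ t, u x t ∂P)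
    (weightedAvg a k (fun i => u y (s i ω)) - ∫ t, u y t ∂P)
  linarith

end UniformDeviation

/-! ### Almost-decreasing sequences and summability of the relative weights. -/

section RobbinsSiegmund

/-- A deterministic Robbins–Siegmund lemma with convergent error series. -/
lemma tendsto_and_summable_of_le {v δ e : ℕ → ℝ} (hδ : ∀ k, 0 ≤ δ k)
    (hstep : ∀ k, v (k + 1) ≤ v k - δ k + e k) {b : ℝ} (hb : ∀ k, b ≤ v k) {c : ℝ}
    (he : Tendsto (fun K => ∑ k ∈ Finset.range K, e k) atTop (𝓝 c)) :
    (∃ l : ℝ, Tendsto v atTop (𝓝 l)) ∧ Summable δ := by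
  obtain ⟨B, hB⟩ := he.bddAbove_range
  have hB' : ∀ K, ∑ k ∈ Finset.range K, e k ≤ B := fun K => hB ⟨K, rfl⟩
  -- Subtracting the partial sums of the errors leaves a nonincreasing sequence, bounded below
  -- because convergent partial sums are bounded.
  let q : ℕ → ℝ := fun K => v K - ∑ k ∈ Finset.range K, e k
  have hq : ∀ k, q (k + 1) ≤ q k - δ k := by
    intro k
    simp only [q, Finset.sum_range_succ]
    linarith [hstep k]
  have hqb : ∀ k, b - B ≤ q k := fun k => by
    simp only [q]; linarith [hb k, hB' k]
  have hanti : Antitone q := antitone_nat_of_succ_le fun k => by linarith [hq k, hδ k]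
  constructor
  · have h1 := tendsto_atTop_ciInf hanti ⟨b - B, by rintro _ ⟨k, rfl⟩; exact hqb k⟩
    refine ⟨_, (h1.add he).congr fun k => ?_⟩
    simp [q]
  · refine summable_of_sum_range_le (c := q 0 - (b - B)) hδ fun K => ?_
    have : ∑ k ∈ Finset.range K, δ k ≤ q 0 - q K := by
      induction K with
      | zero => simp
      | succ K ih => rw [Finset.sum_range_succ]; linarith [hq K]
    linarith [hqb K]

variable {a : ℕ → ℝ}

/-- The relative weights `α_k / A_k`. -/
def relWeight (a : ℕ → ℝ) (k : ℕ) : ℝ := a k / weightSum a k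

lemma relWeight_pos (ha : ∀ k, 0 < a k) (k : ℕ) : 0 < relWeight a k :=
  div_pos (ha k) (weightSum_pos ha k)

lemma AdmissibleWeights.summable_relWeight_mul_rate (ha : AdmissibleWeights a) :
    Summable fun k => relWeight a (k + 1) * rate a k := by
  refine ha.summable.congr fun k => ?_
  rw [relWeight, rate, div_mul_div_comm, mul_comm (weightSum a (k + 1))]

/-- With y_k = 1/β_k² and τ = α_{k+1}/A_{k+1} one has y_{k+1} = (1 - τ)² y_k + τ², hence τ² ≤
y_{k+1} - y_k + 2τ y_k. The differences telescope with 0 ≤ y_k ≤ 1, and y_k is at most the rate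
since β_k ≥ 1, so the rest is summable by assumption. -/
lemma AdmissibleWeights.summable_relWeight_sq (ha : AdmissibleWeights a) :
    Summable fun k => relWeight a k ^ 2 := by
  rw [← summable_nat_add_iff 1]
  have hsum := ha.summable_relWeight_mul_rate
  let y : ℕ → ℝ := fun k => (beta a k ^ 2)⁻¹
  have hy1 : ∀ k, y k ≤ 1 := fun k => inv_le_one_of_one_le₀ (one_le_pow₀ (one_le_beta ha.pos k))
  have hyr : ∀ k, y k ≤ rate a k := by
    intro k
    have h1 := one_le_beta ha.pos k
    have h0 : 0 < beta a k := by linarith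
    simp only [y, rate]
    rw [inv_eq_one_div, div_le_div_iff₀ (by positivity) h0]
    nlinarith [Real.sqrt_nonneg (Real.log (beta a k)),
      mul_nonneg (Real.sqrt_nonneg (Real.log (beta a k))) (sq_nonneg (beta a k))]
  have hrec : ∀ k, relWeight a (k + 1) ^ 2
      ≤ y (k + 1) - y k + 2 * (relWeight a (k + 1) * rate a k) := by
    intro k
    have h1 := weightSum_pos ha.pos k
    have h2 := weightSum_pos ha.pos (k + 1)
    have h3 := weightSum_succ a k
    have h4 : y (k + 1) = (1 - relWeight a (k + 1)) ^ 2 * y k + relWeight a (k + 1) ^ 2 := by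
      simp only [y, beta_sq ha.pos, relWeight, inv_div]
      rw [Finset.sum_range_succ _ (k + 1)]
      have h5 : 1 - a (k + 1) / weightSum a (k + 1) = weightSum a k / weightSum a (k + 1) := by
        field_simp; linarith
      rw [h5]
      field_simp
    have h5 := relWeight_pos ha.pos (k + 1)
    have h6 : 0 ≤ y k := by positivity
    rw [h4]
    nlinarith [mul_le_mul_of_nonneg_left (hyr k) h5.le,
      mul_nonneg (sq_nonneg (relWeight a (k + 1))) h6]
  refine summable_of_sum_range_le (c := 1 + 2 * ∑' k, relWeight a (k + 1) * rate a k)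
    (fun k => sq_nonneg _) fun K => ?_
  have h1 : ∑ k ∈ Finset.range K, relWeight a (k + 1) ^ 2
      ≤ y K - y 0 + 2 * ∑ k ∈ Finset.range K, relWeight a (k + 1) * rate a k := by
    induction K with
    | zero => simp
    | succ K ih =>
      rw [Finset.sum_range_succ, Finset.sum_range_succ]
      linarith [hrec K]
  have h2 := hsum.sum_le_tsum (Finset.range K) fun k _ =>
    (mul_pos (relWeight_pos ha.pos (k + 1)) (rate_pos ha.pos k)).le
  have h3 : 0 ≤ y 0 := by positivity
  linarith [hy1 K]

end RobbinsSiegmund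

/-! ### The martingale formed by the fresh-sample errors, and its measurability. -/

section Martingale

variable {n : ℕ} {Ω : Type*} [MeasurableSpace Ω] {Ω' : Type*} {s : ℕ → Ω' → Ω}
  {x : ℕ → Ω' → E n}

lemma history_mono : Monotone (history s x) := by
  intro k l hkl
  refine sup_le_sup (iSup₂_le fun i hi => ?_) (iSup₂_le fun i hi => ?_)
  · exact le_iSup₂_of_le i (hi.trans_le hkl) le_rfl
  · exact le_iSup₂_of_le i (hi.trans hkl) le_rfl

lemma measurable_iterate_history {i k : ℕ} (h : i ≤ k) : Measurable[history s x k] (x i) :=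
  measurable_iff_comap_le.2 <| (le_iSup₂_of_le
    (f := fun i (_ : i ≤ k) => MeasurableSpace.comap (x i) inferInstance) i h le_rfl).trans
      le_sup_right

lemma measurable_sample_history {i k : ℕ} (h : i < k) : Measurable[history s x k] (s i) :=
  measurable_iff_comap_le.2 <| (le_iSup₂_of_le
    (f := fun i (_ : i < k) => MeasurableSpace.comap (s i) inferInstance) i h le_rfl).trans
      le_sup_left

variable {P : Measure Ω} [MeasurableSpace Ω'] {μ : Measure Ω'} [IsProbabilityMeasure μ]

lemma history_le (hs : ∀ k, Measurable (s k)) (hx : ∀ k, Measurable (x k)) (k : ℕ) :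
    history s x k ≤ ‹MeasurableSpace Ω'› :=
  sup_le (iSup₂_le fun i _ => (hs i).comap_le) (iSup₂_le fun i _ => (hx i).comap_le)

/-- The filtration of the past. -/
def historyFiltration (hs : ∀ k, Measurable (s k)) (hx : ∀ k, Measurable (x k)) :
    Filtration ℕ ‹MeasurableSpace Ω'› where
  seq := history s x
  mono' := history_mono
  le' := history_le hs hx

variable {φ : E n → Ω → ℝ} {B : ℝ}

/-- A function of the current iterate and of the fresh sample, centered in the latter, is
orthogonal to the past. -/
lemma integral_past_mul_centered [IsProbabilityMeasure P]
    (hs : ∀ k, Measurable (s k)) (hx : ∀ k, Measurable (x k))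
    (hlaw : ∀ k, μ.map (s k) = P)
    (hfresh : ∀ k, Indep (MeasurableSpace.comap (s k) inferInstance) (history s x k) μ)
    (hφm : Measurable (Function.uncurry φ)) (hφB : ∀ y t, |φ y t| ≤ B)
    (hφ0 : ∀ y, ∫ t, φ y t ∂P = 0) (k : ℕ) {ψ : Ω' → ℝ} (hψ : Measurable[history s x k] ψ)
    {B' : ℝ} (hψB : ∀ ω, |ψ ω| ≤ B') :
    ∫ ω, ψ ω * φ (x k ω) (s k ω) ∂μ = 0 := by
  have hψ' : Measurable ψ := hψ.mono (history_le hs hx k) le_rfl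
  -- The pair (ψ, x^k) depends only on the history, so its joint law with s^k is a product, and
  -- integrating out s^k first gives zero by Fubini.
  let f : Ω' → ℝ × E n := fun ω => (ψ ω, x k ω)
  have hf : Measurable f := hψ'.prodMk (hx k)
  have hfh : Measurable[history s x k] f := hψ.prodMk (measurable_iterate_history le_rfl)
  have hind : IndepFun f (s k) μ :=
    (indep_of_indep_of_le_left (hfresh k).symm (measurable_iff_comap_le.1 hfh) :
      Indep (MeasurableSpace.comap f inferInstance) _ μ)
  have hmap := hind.map_prod_eq_prod_map_map hf.aemeasurable (hs k).aemeasurable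
  rw [hlaw] at hmap
  let F : (ℝ × E n) × Ω → ℝ := fun q => q.1.1 * φ q.1.2 q.2
  have hF : Measurable F := by
    have : Measurable fun q : (ℝ × E n) × Ω => φ q.1.2 q.2 :=
      hφm.comp ((measurable_snd.comp measurable_fst).prodMk measurable_snd)
    exact (measurable_fst.comp measurable_fst).mul this
  have hg : Measurable fun ω => (f ω, s k ω) := hf.prodMk (hs k)
  have hint : Integrable F (μ.map fun ω => (f ω, s k ω)) := by
    rw [integrable_map_measure hF.aestronglyMeasurable hg.aemeasurable]
    refine Integrable.of_bound (hF.comp hg).aestronglyMeasurable (B' * B)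
      (ae_of_all _ fun ω => ?_)
    simp only [Function.comp, F, f, norm_mul, Real.norm_eq_abs]
    exact mul_le_mul (hψB ω) (hφB _ _) (abs_nonneg _) ((abs_nonneg _).trans (hψB ω))
  have h1 : ∫ ω, ψ ω * φ (x k ω) (s k ω) ∂μ = ∫ q, F q ∂(μ.map fun ω => (f ω, s k ω)) := by
    rw [integral_map hg.aemeasurable hF.aestronglyMeasurable]
  have : IsProbabilityMeasure (μ.map f) := Measure.isProbabilityMeasure_map hf.aemeasurable
  rw [h1, hmap, integral_prod _ (hmap ▸ hint)]
  simp [F, integral_const_mul, hφ0]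

/-- Almost sure convergence of the weighted sum of centered terms. -/
lemma ae_tendsto_sum_centered [IsProbabilityMeasure P]
    (hs : ∀ k, Measurable (s k)) (hx : ∀ k, Measurable (x k))
    (hlaw : ∀ k, μ.map (s k) = P)
    (hfresh : ∀ k, Indep (MeasurableSpace.comap (s k) inferInstance) (history s x k) μ)
    (hφm : Measurable (Function.uncurry φ)) (hφB : ∀ y t, |φ y t| ≤ B)
    (hφ0 : ∀ y, ∫ t, φ y t ∂P = 0) {c : ℕ → ℝ} (hc : Summable fun k => c k ^ 2) :
    ∀ᵐ ω ∂μ, ∃ l : ℝ, Tendsto (fun K => ∑ k ∈ Finset.range K, c k * φ (x k ω) (s k ω))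
      atTop (𝓝 l) := by
  let ℱ := historyFiltration hs hx
  let D : ℕ → Ω' → ℝ := fun k ω => c k * φ (x k ω) (s k ω)
  let S : ℕ → Ω' → ℝ := fun K ω => ∑ k ∈ Finset.range K, D k ω
  have hDh : ∀ k l, k < l → Measurable[history s x l] (D k) := fun k l hkl =>
    (hφm.comp ((measurable_iterate_history hkl.le).prodMk (measurable_sample_history hkl))).const_mul
      _
  have hSh : ∀ K, Measurable[history s x K] (S K) := fun K =>
    Finset.measurable_fun_sum _ fun k hk => hDh k K (Finset.mem_range.1 hk)
  have hDB : ∀ k ω, |D k ω| ≤ |c k| * B := fun k ω => by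
    simp only [D, abs_mul]
    exact mul_le_mul_of_nonneg_left (hφB _ _) (abs_nonneg _)
  have hSB : ∀ K ω, |S K ω| ≤ ∑ k ∈ Finset.range K, |c k| * B := fun K ω =>
    (Finset.abs_sum_le_sum_abs _ _).trans (Finset.sum_le_sum fun k _ => hDB k ω)
  have hSm : ∀ K, Measurable (S K) := fun K => (hSh K).mono (history_le hs hx K) le_rfl
  have hDm : ∀ k, Measurable (D k) := fun k =>
    (hDh k (k + 1) k.lt_succ_self).mono (history_le hs hx _) le_rfl
  have hSi : ∀ K, Integrable (S K) μ := fun K =>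
    Integrable.of_bound (hSm K).aestronglyMeasurable _ (ae_of_all _ (hSB K))
  have hDi : ∀ k, Integrable (D k) μ := fun k =>
    Integrable.of_bound (hDm k).aestronglyMeasurable _ (ae_of_all _ (hDB k))
  have hmart : Martingale S ℱ μ := by
    refine martingale_of_condExp_sub_eq_zero_nat (fun K => (hSh K).stronglyMeasurable) hSi
      fun K => ?_
    have h1 : S (K + 1) - S K = D K := by
      funext ω; simp [S, Finset.sum_range_succ]
    rw [h1]
    refine (ae_eq_condExp_of_forall_setIntegral_eq (ℱ.le K) (hDi K)
      (fun A _ _ => integrableOn_zero) (fun A hA _ => ?_) ?_).symm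
    · have hA' : MeasurableSet[history s x K] A := hA
      have h2 := integral_past_mul_centered hs hx hlaw hfresh hφm hφB hφ0 K
        (ψ := A.indicator fun _ => c K)
        ((@measurable_const _ _ _ (history s x K) (c K)).indicator hA') (B' := |c K|) fun ω => by
          by_cases hω : ω ∈ A <;> simp [hω]
      refine (by simp : ∫ ω in A, (0 : Ω' → ℝ) ω ∂μ = 0).trans ?_
      rw [← h2, ← integral_indicator ((ℱ.le K) A hA)]
      congr 1
      funext ω
      by_cases hω : ω ∈ A <;> simp [hω, D]
    · exact stronglyMeasurable_zero.aestronglyMeasurable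
  -- Increments are orthogonal to the past, so second moments add up. The L¹ bound required by the
  -- convergence theorem then follows from |S| ≤ 1 + S².
  have hL2 : ∀ K, ∫ ω, S K ω ^ 2 ∂μ ≤ ∑ k ∈ Finset.range K, c k ^ 2 * B ^ 2 := by
    intro K
    induction K with
    | zero => simp [S]
    | succ K ih =>
      have hS2 : Integrable (fun ω => S K ω ^ 2) μ :=
        Integrable.of_bound ((hSm K).pow_const 2).aestronglyMeasurable
          ((∑ k ∈ Finset.range K, |c k| * B) ^ 2) (ae_of_all _ fun ω => by
            rw [norm_pow]; exact pow_le_pow_left₀ (norm_nonneg _) (hSB K ω) 2)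
      have hD2 : Integrable (fun ω => D K ω ^ 2) μ :=
        Integrable.of_bound ((hDm K).pow_const 2).aestronglyMeasurable
          ((|c K| * B) ^ 2) (ae_of_all _ fun ω => by
            rw [norm_pow]; exact pow_le_pow_left₀ (norm_nonneg _) (hDB K ω) 2)
      have hSD : Integrable (fun ω => 2 * (S K ω * D K ω)) μ :=
        Integrable.of_bound (((hSm K).mul (hDm K)).const_mul 2).aestronglyMeasurable
          (2 * ((∑ k ∈ Finset.range K, |c k| * B) * (|c K| * B))) (ae_of_all _ fun ω => by
            rw [norm_mul, norm_mul, Real.norm_ofNat]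
            refine mul_le_mul_of_nonneg_left ?_ zero_le_two
            exact mul_le_mul (hSB K ω) (hDB K ω) (norm_nonneg _)
              ((abs_nonneg _).trans (hSB K ω)))
      have h0 : ∫ ω, S K ω * D K ω ∂μ = 0 := by
        have h2 := integral_past_mul_centered hs hx hlaw hfresh hφm hφB hφ0 K (hSh K) (hSB K)
        calc ∫ ω, S K ω * D K ω ∂μ = ∫ ω, c K * (S K ω * φ (x K ω) (s K ω)) ∂μ := by
              congr 1; funext ω; simp only [D]; ring
          _ = 0 := by rw [integral_const_mul, h2, mul_zero]
      have h1 : ∀ ω, S (K + 1) ω ^ 2 = S K ω ^ 2 + 2 * (S K ω * D K ω) + D K ω ^ 2 := fun ω => by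
        simp only [S, Finset.sum_range_succ]; ring
      have h3 : ∫ ω, D K ω ^ 2 ∂μ ≤ c K ^ 2 * B ^ 2 := by
        have := integral_mono hD2 (integrable_const (c K ^ 2 * B ^ 2)) fun ω => by
          have := pow_le_pow_left₀ (abs_nonneg _) (hDB K ω) 2
          simpa only [sq_abs, mul_pow] using this
        simpa using this
      simp_rw [h1]
      rw [integral_add (f := fun ω => S K ω ^ 2 + 2 * (S K ω * D K ω)) (hS2.add hSD) hD2,
        integral_add hS2 hSD, integral_const_mul, h0, Finset.sum_range_succ]
      linarith
  obtain ⟨V, hV⟩ : ∃ V, V = ∑' k, c k ^ 2 * B ^ 2 := ⟨_, rfl⟩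
  have hL1 : ∀ K, eLpNorm (S K) 1 μ ≤ ((1 + V).toNNReal : ℝ≥0∞) := by
    intro K
    rw [eLpNorm_one_eq_lintegral_enorm, ← ofReal_integral_norm_eq_lintegral_enorm (hSi K)]
    refine ENNReal.ofReal_le_ofReal ?_
    have hS2 : Integrable (fun ω => S K ω ^ 2) μ :=
      Integrable.of_bound ((hSm K).pow_const 2).aestronglyMeasurable
        ((∑ k ∈ Finset.range K, |c k| * B) ^ 2) (ae_of_all _ fun ω => by
          rw [norm_pow]; exact pow_le_pow_left₀ (norm_nonneg _) (hSB K ω) 2)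
    calc ∫ ω, ‖S K ω‖ ∂μ ≤ ∫ ω, (1 + S K ω ^ 2) ∂μ := by
          refine integral_mono (hSi K).norm ((integrable_const 1).add hS2) fun ω => ?_
          simp only [Real.norm_eq_abs]
          nlinarith [sq_abs (S K ω), sq_nonneg (|S K ω| - 1), abs_nonneg (S K ω)]
      _ = 1 + ∫ ω, S K ω ^ 2 ∂μ := by
          rw [integral_add (integrable_const 1) hS2]; simp
      _ ≤ 1 + V := by
          have := (hc.mul_right (B ^ 2)).sum_le_tsum (Finset.range K) fun k _ => by positivity
          linarith [hL2 K]
  exact hmart.submartingale.exists_ae_tendsto_of_bdd hL1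

/-- A function that is continuous in the first variable and almost everywhere measurable in the
second one becomes jointly measurable on a full measure set. -/
lemma exists_measurable_uncurry_indicator {u : E n → Ω → ℝ} (hc : ∀ t, Continuous fun y => u y t)
    (hm : ∀ y, AEMeasurable (u y) P) :
    ∃ A : Set Ω, MeasurableSet A ∧ (∀ᵐ t ∂P, t ∈ A) ∧
      Measurable (Function.uncurry fun y => A.indicator (u y)) := by
  let d := TopologicalSpace.denseSeq (E n)
  -- Each section u y agrees with a measurable function only off a null set depending on y. One null
  -- set is removed for a countable dense set of points y, and continuity in y extends measurability
  -- to the others.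
  have h1 : ∀ᵐ t ∂P, ∀ j, u (d j) t = (hm (d j)).mk _ t := ae_all_iff.2 fun j => (hm (d j)).ae_eq_mk
  obtain ⟨N, hN, hNm, hN0⟩ := exists_measurable_superset_of_null (ae_iff.1 h1)
  refine ⟨Nᶜ, hNm.compl, measure_eq_zero_iff_ae_notMem.1 hN0, ?_⟩
  have hd : ∀ j, Measurable (Nᶜ.indicator (u (d j))) := by
    intro j
    have h2 : Nᶜ.indicator (u (d j)) = Nᶜ.indicator ((hm (d j)).mk _) := by
      refine Set.indicator_congr fun t ht => ?_
      by_contra h3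
      exact ht (hN fun h4 => h3 (h4 j))
    rw [h2]
    exact (hm (d j)).measurable_mk.indicator hNm.compl
  refine measurable_uncurry_of_continuous_of_measurable (fun t => ?_) fun y => ?_
  · by_cases ht : t ∈ N
    · simpa [ht] using continuous_const
    · simpa [ht] using hc t
  · obtain ⟨q, hq, hqy⟩ := mem_closure_iff_seq_limit.1
      ((TopologicalSpace.denseRange_denseSeq (E n)) y)
    choose j hj using hq
    refine measurable_of_tendsto_metrizable (fun k => hd (j k)) (tendsto_pi_nhds.2 fun t => ?_)
    by_cases ht : t ∈ N
    · simp [ht]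
    · have := ((hc t).tendsto y).comp hqy
      simpa [ht, d, hj, Function.comp_def] using this

/-- The centered error on a ball, in a jointly measurable version. -/
lemma exists_centered [IsProbabilityMeasure P] {u : E n → Ω → ℝ}
    (hc : ∀ t, Continuous fun y => u y t)
    (hm : ∀ y, AEMeasurable (u y) P) {R M : ℝ} (hM0 : 0 ≤ M)
    (hM : ∀ y ∈ Metric.closedBall (0 : E n) R, ∀ t, |u y t| ≤ M) :
    ∃ φ : E n → Ω → ℝ, Measurable (Function.uncurry φ) ∧ (∀ y t, |φ y t| ≤ 2 * M) ∧
      (∀ y, ∫ t, φ y t ∂P = 0) ∧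
      ∀ᵐ t ∂P, ∀ y ∈ Metric.closedBall (0 : E n) R, φ y t = ∫ t, u y t ∂P - u y t := by
  classical
  obtain ⟨A, hAm, hA, hmeas⟩ := exists_measurable_uncurry_indicator hc hm
  let v : E n → Ω → ℝ := fun y => A.indicator (u y)
  have hvu : ∀ y, v y =ᵐ[P] u y := fun y => by
    filter_upwards [hA] with t ht
    simp [v, ht]
  have hvM : ∀ y ∈ Metric.closedBall (0 : E n) R, ∀ t, |v y t| ≤ M := fun y hy t => by
    by_cases ht : t ∈ A
    · simpa [v, ht] using hM y hy t
    · simpa [v, ht] using hM0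
  have hvy : ∀ y, Measurable (v y) := fun y => hmeas.comp measurable_prodMk_left
  have hVm : Measurable fun y => ∫ t, v y t ∂P :=
    (hmeas.stronglyMeasurable.integral_prod_right (ν := P)).measurable
  have hVM : ∀ y ∈ Metric.closedBall (0 : E n) R, |∫ t, v y t ∂P| ≤ M := fun y hy => by
    have := norm_integral_le_of_norm_le_const (μ := P) (f := v y) (ae_of_all _ (hvM y hy))
    simpa using this
  -- Truncation to the ball keeps the function bounded for all y, so the martingale argument applies
  -- to a run without a uniform bound; on outcomes that stay in the ball it is the true error.
  refine ⟨fun y t => if y ∈ Metric.closedBall (0 : E n) R then (∫ t, v y t ∂P) - v y t else 0,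
    ?_, ?_, ?_, ?_⟩
  · exact Measurable.ite (measurable_fst Metric.isClosed_closedBall.measurableSet)
      ((hVm.comp measurable_fst).sub hmeas) measurable_const
  · intro y t
    by_cases hy : y ∈ Metric.closedBall (0 : E n) R
    · simp only [if_pos hy]
      have := abs_sub (∫ t, v y t ∂P) (v y t)
      linarith [hVM y hy, hvM y hy t]
    · simp only [if_neg hy, abs_zero]; linarith
  · intro y
    by_cases hy : y ∈ Metric.closedBall (0 : E n) R
    · simp only [if_pos hy]
      rw [integral_sub (integrable_const _) (Integrable.of_bound (hvy y).aestronglyMeasurable M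
        (ae_of_all _ (hvM y hy)))]
      simp
    · simp only [if_neg hy, integral_zero]
  · filter_upwards [hA] with t ht y hy
    simp only [if_pos hy]
    rw [integral_congr_ae (hvu y)]
    simp [v, ht]

end Martingale

/-! ### The surrogate values and their one-step descent. -/

lemma inner_weightedAvg {n : ℕ} (a : ℕ → ℝ) (k : ℕ) (v : ℕ → E n) (y : E n) :
    inner ℝ (weightedAvg a k v) y = weightedAvg a k fun i => inner ℝ (v i) y := by
  simp only [weightedAvg, inner_smul_left, sum_inner]
  simp

namespace Program

variable {n : ℕ} {Ω : Type*} [MeasurableSpace Ω] {P : Measure Ω}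
  (p : Program n P)

/-- The part of the objective that is replaced by sample averages, with the opposite sign. -/
def sampled : Scheme → E n → Ω → ℝ
  | .sdca3 => p.h
  | .sdca4 => fun x t => p.h x t - p.g x t

/-- The objective at points where `r₁` and `r₂` are finite. -/
def realObjective (x : E n) : ℝ := p.G x - p.H x + (p.r₁ x).toReal - (p.r₂ x).toReal

lemma objective_eq {x : E n} (h₁ : p.r₁ x ≠ ⊤) (h₂ : p.r₂ x ≠ ⊤) :
    p.objective x = (p.realObjective x : EReal) := by
  rw [objective, if_neg h₁, integral_sub (p.g_integrable x) (p.h_integrable x), realObjective, G, H]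
  conv_lhs => rw [← EReal.coe_toReal h₁ (p.r₁_ne_bot x), ← EReal.coe_toReal h₂ (p.r₂_ne_bot x)]
  norm_cast
  rw [add_sub_assoc]

lemma sampled_continuous (alg : Scheme) (t : Ω) : Continuous fun x => p.sampled alg x t := by
  cases alg
  · exact p.h_continuous t
  · exact (p.h_continuous t).sub (p.g_continuous t)

lemma sampled_aemeasurable (alg : Scheme) (x : E n) : AEMeasurable (p.sampled alg x) P := by
  cases alg
  · exact (p.h_integrable x).aemeasurable
  · exact (p.h_integrable x).aemeasurable.sub (p.g_integrable x).aemeasurable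

variable {p}

lemma Regular.h {alg : Scheme} (hreg : p.Regular alg) : BoundedEquicontinuous p.h := by
  cases alg
  · exact hreg
  · exact hreg.2

/-- For `sdca4` the sampled part h - g need not be convex, so the Lipschitz constants of h and g are
obtained separately and added. -/
lemma Regular.sampled_bound {alg : Scheme} (hreg : p.Regular alg) (R : ℝ) :
    ∃ M Λ : ℝ, 0 < M ∧ 0 < Λ ∧
      (∀ x ∈ Metric.closedBall (0 : E n) R, ∀ t, |p.sampled alg x t| ≤ M) ∧
      ∀ x ∈ Metric.closedBall (0 : E n) R, ∀ y ∈ Metric.closedBall (0 : E n) R, ∀ t,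
        |p.sampled alg x t - p.sampled alg y t| ≤ Λ * ‖x - y‖ := by
  obtain ⟨M, hM0, hM⟩ := hreg.h.exists_bound (isCompact_closedBall (0 : E n) R)
  obtain ⟨Λ, hΛ0, hΛ⟩ := hreg.h.exists_lipschitz p.h_convex R
  cases alg
  · exact ⟨M, Λ, hM0, hΛ0, hM, hΛ⟩
  · obtain ⟨M', hM'0, hM'⟩ := hreg.1.exists_bound (isCompact_closedBall (0 : E n) R)
    obtain ⟨Λ', hΛ'0, hΛ'⟩ := hreg.1.exists_lipschitz p.g_convex R
    refine ⟨M + M', Λ + Λ', by linarith, by linarith, fun x hx t => ?_, fun x hx y hy t => ?_⟩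
    · exact (abs_sub _ _).trans (add_le_add (hM x hx t) (hM' x hx t))
    · have h1 : p.sampled .sdca4 x t - p.sampled .sdca4 y t
          = (p.h x t - p.h y t) - (p.g x t - p.g y t) := by simp only [sampled]; ring
      rw [h1, add_mul]
      exact (abs_sub _ _).trans (add_le_add (hΛ x hx y hy t) (hΛ' x hx y hy t))

lemma convexOn_integral {u : E n → Ω → ℝ} (hc : ∀ t, ConvexOn ℝ Set.univ fun x => u x t)
    (hi : ∀ x, Integrable (u x) P) : ConvexOn ℝ Set.univ fun x => ∫ t, u x t ∂P := by
  refine ⟨convex_univ, fun x _ y _ b c hb hc' hbc => ?_⟩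
  simp only [smul_eq_mul]
  rw [← integral_const_mul, ← integral_const_mul,
    ← integral_add ((hi x).const_mul b) ((hi y).const_mul c)]
  refine integral_mono (hi _) (((hi x).const_mul b).add ((hi y).const_mul c)) fun t => ?_
  simpa using (hc t).2 (Set.mem_univ x) (Set.mem_univ y) hb hc' hbc

lemma convexOn_weightedAvg {Ω : Type*} {a : ℕ → ℝ} (ha : ∀ k, 0 < a k) {u : E n → Ω → ℝ}
    (hc : ∀ t, ConvexOn ℝ Set.univ fun x => u x t) (σ : ℕ → Ω) (k : ℕ) :
    ConvexOn ℝ Set.univ fun x => weightedAvg a k fun i => u x (σ i) := by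
  refine ⟨convex_univ, fun x _ y _ b c hb hc' hbc => ?_⟩
  have h1 : b • (weightedAvg a k fun i => u x (σ i)) + c • (weightedAvg a k fun i => u y (σ i))
      = weightedAvg a k fun i => b * u x (σ i) + c * u y (σ i) := by
    rw [weightedAvg_add]
    simp only [weightedAvg, smul_eq_mul, Finset.mul_sum]
    congr 1 <;> exact Finset.sum_congr rfl fun i _ => by ring
  simp only [h1]
  exact weightedAvg_mono ha fun i _ => (hc (σ i)).2 (Set.mem_univ x) (Set.mem_univ y) hb hc' hbc

lemma continuous_of_convexOn {φ : E n → ℝ} (h : ConvexOn ℝ Set.univ φ) : Continuous φ :=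
  continuousOn_univ.1 (h.continuousOn isOpen_univ)

/-- The strong convexity constants of the `h(·, s)` and of `r₂`. -/
lemma exists_rhoConvex (hρ : 0 < p.modulus) :
    ∃ ρ₁ ρ₂ : ℝ≥0, 0 < ρ₁ + ρ₂ ∧ (∀ t, RhoConvex ρ₁ (ext fun x => p.h x t)) ∧
      RhoConvex ρ₂ p.r₂ := by
  rw [modulus, add_pos_iff] at hρ
  rcases hρ with hρ | hρ
  -- The modulus is a supremum, possibly infinite, so a smaller positive finite constant is chosen.
  -- Only one of the two summands need be positive; the other function enters with constant 0.
  · obtain ⟨ρ, h0, h1⟩ := ENNReal.lt_iff_exists_nnreal_btwn.1 hρ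
    refine ⟨ρ, 0, by simpa using h0, fun t => ?_, p.r₂_convex⟩
    exact exists_rhoConvex_of_lt (h1.trans_le (iInf_le _ t))
  · obtain ⟨ρ, h0, h1⟩ := ENNReal.lt_iff_exists_nnreal_btwn.1 hρ
    exact ⟨0, ρ, by simpa using h0, fun t => rhoConvex_zero_ext (p.h_convex t),
      exists_rhoConvex_of_lt h1⟩

/-- The deterministic relations between the iterates, for one outcome. -/
structure Trajectory (p : Program n P) (alg : Scheme) (a : ℕ → ℝ) (σ : ℕ → Ω) (x : ℕ → E n)
    (z : ℕ → ℕ → E n) (w : ℕ → E n) : Prop where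
  z_mem : ∀ k i : ℕ, i ≤ k → z k i ∈ subdiff (ext fun v => p.h v (σ i)) (x k)
  w_mem : ∀ k : ℕ, w k ∈ subdiff p.r₂ (x k)
  r₁_ne_top : ∀ k, p.r₁ (x k) ≠ ⊤
  optimal : ∀ k y, p.r₁ y ≠ ⊤ →
    p.firstComponent a σ k alg (x (k + 1)) + (p.r₁ (x (k + 1))).toReal
      + inner ℝ (weightedAvg a k (z k) + w k) (y - x (k + 1))
      ≤ p.firstComponent a σ k alg y + (p.r₁ y).toReal

lemma Trajectory.of_isMinOn {alg : Scheme} {a : ℕ → ℝ} {σ : ℕ → Ω} {x : ℕ → E n}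
    {z : ℕ → ℕ → E n} {w : ℕ → E n}
    (hz : ∀ k i : ℕ, i ≤ k → z k i ∈ subdiff (ext fun v => p.h v (σ i)) (x k))
    (hw : ∀ k : ℕ, w k ∈ subdiff p.r₂ (x k)) (h0 : p.r₁ (x 0) ≠ ⊤)
    (hmin : ∀ k : ℕ, IsMinOn (fun v : E n =>
      ((p.firstComponent a σ k alg v : ℝ) : EReal) + p.r₁ v
        - ((inner ℝ (weightedAvg a k (z k) + w k) v : ℝ) : EReal)) Set.univ (x (k + 1))) :
    Trajectory p alg a σ x z w where
  z_mem := hz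
  w_mem := hw
  r₁_ne_top
    | 0 => h0
    | k + 1 => (subproblem_optimality p.r₁_ne_bot (hmin k) h0).1
  optimal k := (subproblem_optimality p.r₁_ne_bot (hmin k) h0).2

/-- The deviation of the sampled part from its mean. -/
def deviation (p : Program n P) (alg : Scheme) (a : ℕ → ℝ) (σ : ℕ → Ω) (k : ℕ) (x : E n) : ℝ :=
  weightedAvg a k (fun i => p.sampled alg x (σ i)) - ∫ t, p.sampled alg x t ∂P

namespace Trajectory

variable {alg : Scheme} {a : ℕ → ℝ} {σ : ℕ → Ω} {x : ℕ → E n} {z : ℕ → ℕ → E n} {w : ℕ → E n}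

lemma r₂_ne_top (hT : Trajectory p alg a σ x z w) (k : ℕ) : p.r₂ (x k) ≠ ⊤ := (hT.w_mem k).1

lemma avg_subgradient (hT : Trajectory p alg a σ x z w) (ha : ∀ k, 0 < a k) {ρ : ℝ≥0}
    (hρ : ∀ t, RhoConvex ρ (ext fun x => p.h x t)) (k : ℕ) (y : E n) :
    weightedAvg a k (fun i => p.h (x k) (σ i)) + inner ℝ (weightedAvg a k (z k)) (y - x k)
      + (ρ : ℝ) / 2 * ‖y - x k‖ ^ 2 ≤ weightedAvg a k fun i => p.h y (σ i) := by
  have h1 : ∀ i ≤ k, p.h (x k) (σ i) + inner ℝ (z k i) (y - x k) + (ρ : ℝ) / 2 * ‖y - x k‖ ^ 2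
      ≤ p.h y (σ i) := fun i hi => by
    have := (hρ (σ i)).subgradient_le (fun _ => EReal.coe_ne_bot _) (hT.z_mem k i hi)
      (y := y) (EReal.coe_ne_top _)
    simpa [ext] using this
  have h2 := weightedAvg_mono (a := a) ha h1
  rw [weightedAvg_add, weightedAvg_add, weightedAvg_const ha] at h2
  rwa [inner_weightedAvg]

/-- The surrogate objectives along the trajectory. -/
def value (p : Program n P) (alg : Scheme) (a : ℕ → ℝ) (σ : ℕ → Ω) (x : ℕ → E n) (k : ℕ) : ℝ :=
  p.realObjective (x k) - p.deviation alg a σ k (x k)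

/-- With the average frozen at step k, the strong subgradient inequalities for h and r₂ at x^k and
the optimality of x^{k+1} tested at x^k add up to the quadratic decrease. The remaining terms come
from replacing the average of index k by that of index k + 1 at x^{k+1}. -/
lemma value_succ_le (hT : Trajectory p alg a σ x z w) (ha : ∀ k, 0 < a k) {ρ₁ ρ₂ : ℝ≥0}
    (hρ₁ : ∀ t, RhoConvex ρ₁ (ext fun x => p.h x t)) (hρ₂ : RhoConvex ρ₂ p.r₂) (k : ℕ) :
    value p alg a σ x (k + 1) ≤ value p alg a σ x k
      - ((ρ₁ + ρ₂ : ℝ≥0) : ℝ) / 2 * ‖x (k + 1) - x k‖ ^ 2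
      + (relWeight a (k + 1) * p.deviation alg a σ k (x (k + 1)) + relWeight a (k + 1) *
        (∫ t, p.sampled alg (x (k + 1)) t ∂P - p.sampled alg (x (k + 1)) (σ (k + 1)))) := by
  have h1 := hT.avg_subgradient ha hρ₁ k (x (k + 1))
  have h2 := hρ₂.subgradient_le p.r₂_ne_bot (hT.w_mem k) (hT.r₂_ne_top (k + 1))
  have h3 := hT.optimal k (x k) (hT.r₁_ne_top k)
  have h4 : inner ℝ (weightedAvg a k (z k) + w k) (x k - x (k + 1))
      = - inner ℝ (weightedAvg a k (z k)) (x (k + 1) - x k)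
        - inner ℝ (w k) (x (k + 1) - x k) := by
    rw [← neg_sub (x (k + 1)) (x k), inner_neg_right, inner_add_left]; ring
  rw [h4] at h3
  -- The recursion moves the average towards the fresh sample; inserting the mean splits this
  -- increment into the deviation D_k and a centered term.
  have h5 : value p alg a σ x (k + 1) = p.realObjective (x (k + 1))
      - p.deviation alg a σ k (x (k + 1))
      + (relWeight a (k + 1) * p.deviation alg a σ k (x (k + 1)) + relWeight a (k + 1) *
        (∫ t, p.sampled alg (x (k + 1)) t ∂P - p.sampled alg (x (k + 1)) (σ (k + 1)))) := by
    rw [value, deviation, deviation, weightedAvg_succ ha, relWeight]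
    ring
  rw [h5, value]
  push_cast
  cases alg
  · simp only [firstComponent] at h3
    simp only [deviation, sampled, realObjective]
    have h6 : ∀ y, ∫ t, p.h y t ∂P = p.H y := fun _ => rfl
    simp only [h6]
    linarith
  · simp only [firstComponent] at h3
    simp only [deviation, sampled, realObjective]
    have h6 : ∀ y, ∫ t, (p.h y t - p.g y t) ∂P = p.H y - p.G y := fun y =>
      integral_sub (p.h_integrable y) (p.g_integrable y)
    simp only [h6, weightedAvg_sub]
    linarith

end Trajectory

end Program

/-! ### Passage to the limit and criticality of limit points. -/

section LimitTools

variable {n : ℕ}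

/-- Lower semicontinuity along a sequence, in terms of finite values. -/
lemma toReal_le_of_tendsto {φ : E n → EReal} (hφ : ∀ x, φ x ≠ ⊥) (hlsc : LowerSemicontinuous φ)
    {ξ : ℕ → E n} {y : E n} (hξ : Tendsto ξ atTop (𝓝 y)) (hfin : ∀ j, φ (ξ j) ≠ ⊤)
    {c : ℕ → ℝ} {c₀ : ℝ} (hc : Tendsto c atTop (𝓝 c₀)) (hle : ∀ j, (φ (ξ j)).toReal ≤ c j) :
    φ y ≠ ⊤ ∧ (φ y).toReal ≤ c₀ := by
  have h1 : φ y ≤ (c₀ : EReal) := by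
    by_contra! h
    obtain ⟨d, hd1, hd2⟩ := EReal.lt_iff_exists_real_btwn.1 h
    have h2 := hξ.eventually (hlsc y d hd2)
    have h3 := hc.eventually (gt_mem_nhds (by exact_mod_cast hd1 : c₀ < d))
    obtain ⟨j, h4, h5⟩ := (h2.and h3).exists
    rw [← EReal.coe_toReal (hfin j) (hφ _)] at h4
    have h6 : d < (φ (ξ j)).toReal := by exact_mod_cast h4
    linarith [hle j]
  have h2 : φ y ≠ ⊤ := fun h => by
    rw [h] at h1; exact EReal.coe_ne_top _ (top_le_iff.1 h1)
  refine ⟨h2, ?_⟩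
  rw [← EReal.coe_toReal h2 (hφ y)] at h1
  exact_mod_cast h1

/-- `F_k → F` uniformly on bounded sets. -/
def LocallyUniformLimit (F : ℕ → E n → ℝ) (F₀ : E n → ℝ) : Prop :=
  ∀ R : ℕ, ∀ ε > 0, ∀ᶠ k in atTop, ∀ x ∈ Metric.closedBall (0 : E n) R, |F k x - F₀ x| ≤ ε

lemma LocallyUniformLimit.tendsto {F : ℕ → E n → ℝ} {F₀ : E n → ℝ}
    (h : LocallyUniformLimit F F₀) (hF₀ : Continuous F₀) {ξ : ℕ → E n} {y : E n} {κ : ℕ → ℕ}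
    (hκ : Tendsto κ atTop atTop) (hξ : Tendsto ξ atTop (𝓝 y)) :
    Tendsto (fun j => F (κ j) (ξ j)) atTop (𝓝 (F₀ y)) := by
  obtain ⟨R, hR⟩ := exists_nat_gt ‖y‖
  have h0 : ∀ᶠ j in atTop, ξ j ∈ Metric.closedBall (0 : E n) R := by
    filter_upwards [hξ.norm.eventually (gt_mem_nhds hR)] with j hj
    simpa using hj.le
  have h1 : Tendsto (fun j => F (κ j) (ξ j) - F₀ (ξ j)) atTop (𝓝 0) := by
    rw [Metric.tendsto_nhds]
    intro ε hε
    filter_upwards [h0, hκ.eventually (h R (ε / 2) (half_pos hε))] with j hj hk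
    rw [Real.dist_0_eq_abs]
    linarith [hk _ hj]
  simpa using h1.add ((hF₀.tendsto y).comp hξ)

/-- Testing the subgradient inequality at the unit step x + v/‖v‖ makes the inner product equal to
‖v‖, which is thus at most the oscillation of φ. -/
lemma norm_le_of_mem_subdiff {φ : E n → ℝ} {x v : E n} (hv : v ∈ subdiff (ext φ) x) {R M : ℝ}
    (hx : ‖x‖ ≤ R) (hM : ∀ y ∈ Metric.closedBall (0 : E n) (R + 1), |φ y| ≤ M) :
    ‖v‖ ≤ 2 * M := by
  have hx' : x ∈ Metric.closedBall (0 : E n) (R + 1) := by simp; linarith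
  by_cases h0 : v = 0
  · rw [h0, norm_zero]; linarith [hM x hx', abs_nonneg (φ x)]
  have hv0 : 0 < ‖v‖ := norm_pos_iff.2 h0
  have h1 := mem_subdiff_ext_iff.1 hv (x + ‖v‖⁻¹ • v)
  have h2 : x + ‖v‖⁻¹ • v ∈ Metric.closedBall (0 : E n) (R + 1) := by
    simp only [mem_closedBall_zero_iff]
    refine (norm_add_le _ _).trans (add_le_add hx ?_)
    rw [norm_smul, norm_inv, norm_norm, inv_mul_cancel₀ hv0.ne']
  rw [add_sub_cancel_left, inner_smul_right, real_inner_self_eq_norm_sq, pow_two,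
    inv_mul_cancel_left₀ hv0.ne'] at h1
  linarith [abs_le.1 (hM _ h2), (abs_le.1 (hM _ hx')).1]

end LimitTools

namespace Program

variable {n : ℕ} {Ω : Type*} [MeasurableSpace Ω] {P : Measure Ω} {p : Program n P}
  {alg : Scheme} {a : ℕ → ℝ}

/-- Limit points of a bounded trajectory with bounded `w` are critical. -/
lemma Trajectory.isCritical {σ : ℕ → Ω} {x : ℕ → E n} {z : ℕ → ℕ → E n} {w : ℕ → E n}
    (hT : Trajectory p alg a σ x z w) (ha : ∀ k, 0 < a k) (hreg : p.Regular alg)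
    (hH : LocallyUniformLimit (fun k v => weightedAvg a k fun i => p.h v (σ i)) p.H)
    (hG : LocallyUniformLimit (fun k => p.firstComponent a σ k alg) p.G)
    {R : ℝ} (hR : ∀ k, ‖x k‖ ≤ R) (hΔ : Tendsto (fun k => ‖x (k + 1) - x k‖) atTop (𝓝 0))
    {W : ℝ} (hW : ∀ k, ‖w k‖ ≤ W) {y : E n} (hy : MapClusterPt y atTop x) :
    p.IsCritical y := by
  have hGc : Continuous p.G := continuous_of_convexOn (convexOn_integral p.g_convex p.g_integrable)
  have hHc : Continuous p.H := continuous_of_convexOn (convexOn_integral p.h_convex p.h_integrable)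
  obtain ⟨M, hM0, hM⟩ := hreg.h.exists_bound (isCompact_closedBall (0 : E n) (R + 1))
  have hY : ∀ k, ‖weightedAvg a k (z k)‖ ≤ 2 * M := fun k =>
    norm_weightedAvg_le ha fun i hi =>
      norm_le_of_mem_subdiff (hT.z_mem k i hi) (hR k) fun v hv => hM v hv (σ i)
  obtain ⟨κ₀, hκ₀, hxκ₀⟩ := MapClusterPt.tendsto_subseq hy
  obtain ⟨⟨Y, w₀⟩, -, κ₁, hκ₁, hYw⟩ := tendsto_subseq_of_bounded
    (s := Metric.closedBall (0 : E n) (2 * M) ×ˢ Metric.closedBall (0 : E n) W)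
    (Metric.isBounded_closedBall.prod Metric.isBounded_closedBall)
    (x := fun j => (weightedAvg a (κ₀ j) (z (κ₀ j)), w (κ₀ j)))
    (fun j => ⟨by simpa using hY _, by simpa using hW _⟩)
  let κ := κ₀ ∘ κ₁
  have hκ : Tendsto κ atTop atTop := hκ₀.tendsto_atTop.comp hκ₁.tendsto_atTop
  have hx : Tendsto (fun j => x (κ j)) atTop (𝓝 y) := hxκ₀.comp hκ₁.tendsto_atTop
  have hYlim : Tendsto (fun j => weightedAvg a (κ j) (z (κ j))) atTop (𝓝 Y) :=
    (continuous_fst.tendsto _).comp hYw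
  have hwlim : Tendsto (fun j => w (κ j)) atTop (𝓝 w₀) := (continuous_snd.tendsto _).comp hYw
  -- The subgradients live at x^k but optimality holds at x^{k+1}; vanishing steps give both the
  -- same limit.
  have hx' : Tendsto (fun j => x (κ j + 1)) atTop (𝓝 y) := by
    have h1 : Tendsto (fun j => x (κ j + 1) - x (κ j)) atTop (𝓝 0) :=
      tendsto_zero_iff_norm_tendsto_zero.2 (hΔ.comp hκ)
    simpa using h1.add hx
  have hYsub : Y ∈ subdiff (ext p.H) y := by
    refine mem_subdiff_ext_iff.2 fun v => ?_
    have h1 := hH.tendsto hHc hκ hx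
    have h2 := hH.tendsto hHc hκ (tendsto_const_nhds (x := v))
    refine le_of_tendsto_of_tendsto' (h1.add (hYlim.inner (tendsto_const_nhds.sub hx))) h2
      fun j => ?_
    have := hT.avg_subgradient ha (fun t => rhoConvex_zero_ext (p.h_convex t)) (κ j) v
    simpa using this
  have hwsub : w₀ ∈ subdiff p.r₂ y := by
    have key : ∀ v, p.r₂ v ≠ ⊤ → p.r₂ y ≠ ⊤ ∧
        (p.r₂ y).toReal ≤ (p.r₂ v).toReal - inner ℝ w₀ (v - y) := fun v hv => by
      refine toReal_le_of_tendsto p.r₂_ne_bot p.r₂_lsc hx (fun j => hT.r₂_ne_top (κ j))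
        (tendsto_const_nhds.sub (hwlim.inner (tendsto_const_nhds.sub hx))) fun j => ?_
      have := ((mem_subdiff_iff p.r₂_ne_bot).1 (hT.w_mem (κ j))).2 v hv
      linarith
    exact (mem_subdiff_iff p.r₂_ne_bot).2
      ⟨(key _ (hT.r₂_ne_top 0)).1, fun v hv => by linarith [(key v hv).2]⟩
  -- The limit of the optimality inequalities says that `Y + w₀` is a subgradient of G + r₁ at y,
  -- with finiteness of r₁ there coming from lower semicontinuity.
  have hopt : ∀ v, p.r₁ v ≠ ⊤ → p.r₁ y ≠ ⊤ ∧
      (p.r₁ y).toReal ≤ p.G v + (p.r₁ v).toReal - p.G y - inner ℝ (Y + w₀) (v - y) := by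
    intro v hv
    have h1 := hG.tendsto hGc hκ hx'
    have h2 := hG.tendsto hGc hκ (tendsto_const_nhds (x := v))
    refine toReal_le_of_tendsto p.r₁_ne_bot p.r₁_lsc hx' (fun j => hT.r₁_ne_top (κ j + 1))
      (((h2.add_const _).sub h1).sub ((hYlim.add hwlim).inner (tendsto_const_nhds.sub hx')))
      fun j => ?_
    linarith [hT.optimal (κ j) v hv]
  obtain ⟨u, hu, hu'⟩ := exists_subgradient_add (convexOn_integral p.g_convex p.g_integrable) hGc
    p.r₁_ne_bot p.r₁_convex (hopt _ (hT.r₁_ne_top 0)).1 (v := Y + w₀) (x := y)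
    fun v hv => by
      have := (hopt v hv).2
      change p.G y + _ + _ ≤ p.G v + _
      linarith
  refine ⟨u + (Y + w₀ - u) - Y, ?_, w₀, hwsub, by simp⟩
  exact ⟨_, ⟨u, hu, _, hu', rfl⟩, Y, hYsub, rfl⟩

end Program

/-! ### Almost sure convergence: part (i). -/

section PartOne

variable {n : ℕ} {Ω : Type*} [MeasurableSpace Ω] {P : Measure Ω}
  {p : Program n P} {Ω' : Type*} [MeasurableSpace Ω'] {μ : Measure Ω'}
  {alg : Scheme} {a : ℕ → ℝ} {x₀ : E n} {s : ℕ → Ω' → Ω} {x : ℕ → Ω' → E n}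
  {z : ℕ → ℕ → Ω' → E n} {w : ℕ → Ω' → E n}

lemma ae_locallyUniformLimit [IsProbabilityMeasure P] [IsProbabilityMeasure μ]
    (ha : AdmissibleWeights a) (hs : ∀ k, Measurable (s k))
    (hlaw : ∀ k, μ.map (s k) = P) (hind : iIndepFun s μ) {u : E n → Ω → ℝ}
    (hc : ∀ t, ConvexOn ℝ Set.univ fun x => u x t) (hi : ∀ x, Integrable (u x) P)
    (hu : BoundedEquicontinuous u) :
    ∀ᵐ ω ∂μ, LocallyUniformLimit (fun k v => weightedAvg a k fun i => u v (s i ω))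
      fun v => ∫ t, u v t ∂P := by
  refine ae_all_iff.2 fun R => ?_
  obtain ⟨M, -, hM⟩ := hu.exists_bound (isCompact_closedBall (0 : E n) R)
  obtain ⟨Λ, hΛ0, hΛ⟩ := hu.exists_lipschitz hc R
  exact ae_uniform_deviation ha hs hlaw hind (Nat.cast_nonneg R) subset_rfl
    (fun x _ => (hi x).aemeasurable) hM hΛ0.le hΛ

lemma IsRun.ae_trajectory (hrun : IsRun p alg a μ x₀ s x z w) :
    ∀ᵐ ω ∂μ, p.Trajectory alg a (fun i => s i ω) (fun k => x k ω) (fun k i => z k i ω)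
      (fun k => w k ω) := by
  filter_upwards [hrun.z_mem, hrun.w_mem, hrun.step] with ω h1 h2 h3
  exact .of_isMinOn h1 h2 (by rw [hrun.start_eq]; exact hrun.start_mem) h3

lemma ae_comp_sample {τ : Ω' → Ω} (hτ : Measurable τ) (hlaw : μ.map τ = P) {q : Ω → Prop}
    (hq : ∀ᵐ t ∂P, q t) : ∀ᵐ ω ∂μ, q (τ ω) := by
  subst hlaw
  exact ae_of_ae_map hτ.aemeasurable hq

/-- The data controlling the errors on the ball of radius `R`. -/
structure ErrorControl (p : Program n P) (alg : Scheme) (a : ℕ → ℝ) (μ : Measure Ω')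
    (s : ℕ → Ω' → Ω) (x : ℕ → Ω' → E n) (R M c : ℝ) (Z : ℕ → Ω' → ℝ) (φ : E n → Ω → ℝ) :
    Prop where
  M_pos : 0 < M
  deviation_le_bound : ∀ σ k, ∀ y ∈ Metric.closedBall (0 : E n) R,
    |p.deviation alg a σ k y| ≤ 2 * M
  integrable_Z : ∀ k, Integrable (Z k) μ
  Z_nonneg : ∀ k ω, 0 ≤ Z k ω
  deviation_le : ∀ k ω, ∀ y ∈ Metric.closedBall (0 : E n) R,
    |p.deviation alg a (fun i => s i ω) k y| ≤ Z k ω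
  c_nonneg : 0 ≤ c
  integral_Z_le : ∀ k, ∫ ω, Z k ω ∂μ ≤ c * rate a k
  measurable_φ : Measurable (Function.uncurry φ)
  abs_φ_le : ∀ y t, |φ y t| ≤ 2 * M
  integral_φ : ∀ y, ∫ t, φ y t ∂P = 0
  φ_eq : ∀ᵐ ω ∂μ, ∀ k, ∀ y ∈ Metric.closedBall (0 : E n) R,
    φ y (s k ω) = ∫ t, p.sampled alg y t ∂P - p.sampled alg y (s k ω)

lemma exists_errorControl [IsProbabilityMeasure P] [IsProbabilityMeasure μ]
    (ha : ∀ k, 0 < a k) (hreg : p.Regular alg)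
    (hrun : IsRun p alg a μ x₀ s x z w) {R : ℝ} (hR : 0 ≤ R) :
    ∃ M c Z φ, ErrorControl p alg a μ s x R M c Z φ := by
  obtain ⟨M, Λ, hM0, hΛ0, hM, hΛ⟩ := hreg.sampled_bound R
  obtain ⟨c, Z, hc, hZ⟩ := exists_uniform_deviation_bound ha hrun.sample_measurable
    hrun.sample_law hrun.sample_indep hR subset_rfl (fun y _ => p.sampled_aemeasurable alg y) hM
    hΛ0.le hΛ
  obtain ⟨φ, h1, h2, h3, h4⟩ := exists_centered (p.sampled_continuous alg)
    (p.sampled_aemeasurable alg) hM0.le hM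
  refine ⟨M, c, Z, φ, hM0, fun σ k y hy => ?_, fun k => (hZ k).1, fun k ω => ?_,
    fun k ω => (hZ k).2.1 ω, hc, fun k => (hZ k).2.2, h1, h2, h3, ?_⟩
  · have h5 : |weightedAvg a k fun i => p.sampled alg y (σ i)| ≤ M :=
      norm_weightedAvg_le (v := fun i => p.sampled alg y (σ i)) ha fun i _ => hM y hy _
    have h6 : |∫ t, p.sampled alg y t ∂P| ≤ M := by
      simpa using norm_integral_le_of_norm_le_const (μ := P) (f := p.sampled alg y)
        (ae_of_all _ (hM y hy))
    exact (abs_sub _ _).trans (by linarith)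
  · exact (abs_nonneg _).trans ((hZ k).2.1 ω 0 (by simpa using hR))
  · refine ae_all_iff.2 fun k => ?_
    exact ae_comp_sample (hrun.sample_measurable k) (hrun.sample_law k) h4

/-- The almost sure convergence of the error series on the ball of radius `R`. -/
lemma ErrorControl.ae_tendsto [IsProbabilityMeasure P] [IsProbabilityMeasure μ]
    (ha : AdmissibleWeights a)
    (hrun : IsRun p alg a μ x₀ s x z w) {R M c : ℝ} {Z : ℕ → Ω' → ℝ} {φ : E n → Ω → ℝ}
    (hE : ErrorControl p alg a μ s x R M c Z φ) :
    ∀ᵐ ω ∂μ, ∃ l : ℝ, Tendsto (fun K => ∑ k ∈ Finset.range K,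
      (relWeight a (k + 1) * Z k ω + relWeight a (k + 1) * φ (x (k + 1) ω) (s (k + 1) ω)))
      atTop (𝓝 l) := by
  have h1 := ae_tendsto_sum_centered hrun.sample_measurable hrun.iterate_measurable
    hrun.sample_law hrun.sample_fresh hE.measurable_φ hE.abs_φ_le hE.integral_φ
    ha.summable_relWeight_sq
  have h2 : ∀ᵐ ω ∂μ, Summable fun k => relWeight a (k + 1) * Z k ω := by
    have hwpos := fun k => relWeight_pos ha.pos (k + 1)
    have hint : ∫⁻ ω, ∑' k, ENNReal.ofReal (relWeight a (k + 1) * Z k ω) ∂μ ≠ ∞ := by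
      rw [lintegral_tsum fun k =>
        ((hE.integrable_Z k).aemeasurable.const_mul _).ennreal_ofReal]
      have h3 : ∀ k, ∫⁻ ω, ENNReal.ofReal (relWeight a (k + 1) * Z k ω) ∂μ
          ≤ ENNReal.ofReal (c * (relWeight a (k + 1) * rate a k)) := by
        intro k
        rw [← ofReal_integral_eq_lintegral_ofReal ((hE.integrable_Z k).const_mul _)
          (ae_of_all _ fun ω => mul_nonneg (hwpos k).le (hE.Z_nonneg k ω)), integral_const_mul]
        refine ENNReal.ofReal_le_ofReal ?_
        calc _ ≤ relWeight a (k + 1) * (c * rate a k) :=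
              mul_le_mul_of_nonneg_left (hE.integral_Z_le k) (hwpos k).le
          _ = _ := by ring
      refine ne_top_of_le_ne_top ?_ (ENNReal.tsum_le_tsum h3)
      exact (ha.summable_relWeight_mul_rate.mul_left c).tsum_ofReal_ne_top
    have hmeas : AEMeasurable (fun ω => ∑' k, ENNReal.ofReal (relWeight a (k + 1) * Z k ω)) μ :=
      AEMeasurable.tsum fun k =>
        ((hE.integrable_Z k).aemeasurable.const_mul _).ennreal_ofReal
    filter_upwards [ae_lt_top' hmeas hint] with ω hω
    have h4 := ENNReal.summable_toReal hω.ne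
    refine h4.congr fun k => ?_
    exact ENNReal.toReal_ofReal (mul_nonneg (hwpos k).le (hE.Z_nonneg k ω))
  filter_upwards [h1, h2] with ω ⟨l, hl⟩ hω
  -- The martingale series starts at k = 0 while the errors start at k = 1, so its first term is
  -- subtracted.
  have h3 := (tendsto_add_atTop_iff_nat 1).2 hl
  have h4 := (hω.hasSum.tendsto_sum_nat).add (h3.sub_const (relWeight a 0 * φ (x 0 ω) (s 0 ω)))
  refine ⟨_, h4.congr fun K => ?_⟩
  rw [Finset.sum_add_distrib, Finset.sum_range_succ']
  ring

lemma realObjective_ge {v : ℝ} (hv : ⨅ y, p.objective y = (v : EReal)) {y : E n}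
    (h₁ : p.r₁ y ≠ ⊤) (h₂ : p.r₂ y ≠ ⊤) : v ≤ p.realObjective y := by
  have := iInf_le p.objective y
  rw [hv, p.objective_eq h₁ h₂] at this
  exact_mod_cast this

/-- The one-step inequality with the controlled errors. -/
lemma ErrorControl.value_succ_le (ha : ∀ k, 0 < a k) {ρ₁ ρ₂ : ℝ≥0}
    (hρ₁ : ∀ t, RhoConvex ρ₁ (ext fun x => p.h x t)) (hρ₂ : RhoConvex ρ₂ p.r₂)
    {R M c : ℝ} {Z : ℕ → Ω' → ℝ} {φ : E n → Ω → ℝ}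
    (hE : ErrorControl p alg a μ s x R M c Z φ) {ω : Ω'}
    (hT : p.Trajectory alg a (fun i => s i ω) (fun k => x k ω) (fun k i => z k i ω)
      (fun k => w k ω))
    (hφ : ∀ k, ∀ y ∈ Metric.closedBall (0 : E n) R,
      φ y (s k ω) = ∫ t, p.sampled alg y t ∂P - p.sampled alg y (s k ω))
    (hR : ∀ k, ‖x k ω‖ ≤ R) (k : ℕ) :
    Program.Trajectory.value p alg a (fun i => s i ω) (fun k => x k ω) (k + 1)
      ≤ Program.Trajectory.value p alg a (fun i => s i ω) (fun k => x k ω) k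
        - ((ρ₁ + ρ₂ : ℝ≥0) : ℝ) / 2 * ‖x (k + 1) ω - x k ω‖ ^ 2
        + (relWeight a (k + 1) * Z k ω
          + relWeight a (k + 1) * φ (x (k + 1) ω) (s (k + 1) ω)) := by
  have hmem : x (k + 1) ω ∈ Metric.closedBall (0 : E n) R := by simpa using hR (k + 1)
  have h1 := hT.value_succ_le ha hρ₁ hρ₂ k
  rw [← hφ (k + 1) _ hmem] at h1
  have h2 := (le_abs_self _).trans (hE.deviation_le k ω _ hmem)
  have h3 := mul_le_mul_of_nonneg_left h2 (relWeight_pos ha (k + 1)).le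
  linarith

lemma ErrorControl.le_value {R M c : ℝ} {Z : ℕ → Ω' → ℝ} {φ : E n → Ω → ℝ}
    (hE : ErrorControl p alg a μ s x R M c Z φ) {ω : Ω'}
    (hT : p.Trajectory alg a (fun i => s i ω) (fun k => x k ω) (fun k i => z k i ω)
      (fun k => w k ω)) (hR : ∀ k, ‖x k ω‖ ≤ R)
    {v : ℝ} (hv : ⨅ y, p.objective y = (v : EReal)) (k : ℕ) :
    v - 2 * M ≤ Program.Trajectory.value p alg a (fun i => s i ω) (fun k => x k ω) k := by
  have h1 := realObjective_ge hv (hT.r₁_ne_top k) (hT.r₂_ne_top k)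
  have h2 := hE.deviation_le_bound (fun i => s i ω) k (x k ω) (by simpa using hR k)
  rw [Program.Trajectory.value]
  linarith [(abs_le.1 h2).2]

/-- Convergence of the values, and square summability of the steps. -/
lemma IsRun.ae_tendsto_and_summable [IsProbabilityMeasure P] [IsProbabilityMeasure μ]
    (ha : AdmissibleWeights a) (hreg : p.Regular alg)
    (hrun : IsRun p alg a μ x₀ s x z w) (hopt : p.FiniteOptimalValue)
    (hbdd : ∀ᵐ ω ∂μ, BddAbove (Set.range fun k => ‖x k ω‖)) (hρ : 0 < p.modulus) :
    ∀ᵐ ω ∂μ, (∃ l : ℝ, Tendsto (fun k => p.objective (x k ω)) atTop (𝓝 (l : EReal))) ∧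
      Summable fun k => ‖x (k + 1) ω - x k ω‖ ^ 2 := by
  obtain ⟨v, hv⟩ := hopt
  obtain ⟨ρ₁, ρ₂, hρ0, hρ₁, hρ₂⟩ := Program.exists_rhoConvex hρ
  -- The bound on the iterates may depend on the outcome. Everything is proved on the event of
  -- staying in the ball of radius R, and countably many integer radii cover almost every outcome.
  have hball : ∀ R : ℕ, ∀ᵐ ω ∂μ, (∀ k, ‖x k ω‖ ≤ R) →
      (∃ l : ℝ, Tendsto (fun k => p.objective (x k ω)) atTop (𝓝 (l : EReal))) ∧
      Summable fun k => ‖x (k + 1) ω - x k ω‖ ^ 2 := by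
    intro R
    obtain ⟨M, c, Z, φ, hE⟩ := exists_errorControl ha.pos hreg hrun (Nat.cast_nonneg R)
    obtain ⟨M', Λ, hM0, hΛ0, hM, hΛ⟩ := hreg.sampled_bound (R : ℝ)
    have hdev := ae_uniform_deviation ha hrun.sample_measurable hrun.sample_law
      hrun.sample_indep (Nat.cast_nonneg R) subset_rfl
      (fun y _ => p.sampled_aemeasurable alg y) hM hΛ0.le hΛ
    filter_upwards [hrun.ae_trajectory, hE.φ_eq, hE.ae_tendsto ha hrun, hdev]
      with ω hT hφ ⟨l, hl⟩ hdev hR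
    have hmem : ∀ k, x k ω ∈ Metric.closedBall (0 : E n) R := fun k => by simpa using hR k
    obtain ⟨⟨l', hl'⟩, hsum⟩ := tendsto_and_summable_of_le
      (v := Program.Trajectory.value p alg a (fun i => s i ω) (fun k => x k ω))
      (δ := fun k => ((ρ₁ + ρ₂ : ℝ≥0) : ℝ) / 2 * ‖x (k + 1) ω - x k ω‖ ^ 2)
      (fun k => by positivity) (hE.value_succ_le ha.pos hρ₁ hρ₂ hT hφ hR)
      (hE.le_value hT hR hv) hl
    constructor
    · refine ⟨l', ?_⟩
      have h1 : Tendsto (fun k => p.deviation alg a (fun i => s i ω) k (x k ω)) atTop (𝓝 0) := by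
        rw [Metric.tendsto_nhds]
        intro ε hε
        filter_upwards [hdev (ε / 2) (half_pos hε)] with k hk
        rw [Real.dist_0_eq_abs]
        exact (hk _ (hmem k)).trans_lt (half_lt_self hε)
      have h2 : Tendsto (fun k => p.realObjective (x k ω)) atTop (𝓝 l') := by
        simpa [Program.Trajectory.value] using hl'.add h1
      refine ((continuous_coe_real_ereal.tendsto l').comp h2).congr fun k => ?_
      exact (p.objective_eq (hT.r₁_ne_top k) (hT.r₂_ne_top k)).symm
    · refine (summable_mul_left_iff ?_).1 hsum
      have : (0 : ℝ) < ((ρ₁ + ρ₂ : ℝ≥0) : ℝ) := by exact_mod_cast hρ0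
      positivity
  filter_upwards [hbdd, ae_all_iff.2 hball] with ω ⟨B, hB⟩ hω
  obtain ⟨R, hR⟩ := exists_nat_ge B
  exact hω R fun k => (hB ⟨k, rfl⟩).trans hR

/-- Criticality of the limit points. -/
lemma IsRun.ae_isCritical [IsProbabilityMeasure P] [IsProbabilityMeasure μ]
    (ha : AdmissibleWeights a) (hreg : p.Regular alg)
    (hrun : IsRun p alg a μ x₀ s x z w)
    (hbdd : ∀ᵐ ω ∂μ, BddAbove (Set.range fun k => ‖x k ω‖))
    (hsum : ∀ᵐ ω ∂μ, Summable fun k => ‖x (k + 1) ω - x k ω‖ ^ 2) :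
    ∀ᵐ ω ∂μ, BddAbove (Set.range fun k => ‖w k ω‖) →
      ∀ y : E n, MapClusterPt y atTop (fun k => x k ω) → p.IsCritical y := by
  have hH := ae_locallyUniformLimit ha hrun.sample_measurable hrun.sample_law hrun.sample_indep
    p.h_convex p.h_integrable hreg.h
  have hG : ∀ᵐ ω ∂μ,
      LocallyUniformLimit (fun k => p.firstComponent a (fun i => s i ω) k alg) p.G := by
    cases alg
    · refine ae_of_all _ fun ω R ε hε => Eventually.of_forall fun k y _ => ?_
      simpa [Program.firstComponent] using hε.le
    · exact ae_locallyUniformLimit ha hrun.sample_measurable hrun.sample_law hrun.sample_indep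
        p.g_convex p.g_integrable hreg.1
  filter_upwards [hrun.ae_trajectory, hbdd, hsum, hH, hG]
    with ω hT ⟨B, hB⟩ hsum hH hG ⟨W, hW⟩ y hy
  have hΔ : Tendsto (fun k => ‖x (k + 1) ω - x k ω‖) atTop (𝓝 0) := by
    have := hsum.tendsto_atTop_zero.sqrt
    simpa [Real.sqrt_sq] using this
  exact hT.isCritical ha.pos hreg hH hG (fun k => hB ⟨k, rfl⟩) hΔ (fun k => hW ⟨k, rfl⟩) hy

end PartOne

/-! ### Mean gradients and the deviation of averaged gradients. -/

section Gradients

variable {n : ℕ}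

lemma norm_le_sum_abs (v : E n) : ‖v‖ ≤ ∑ j, |v j| := by
  refine (pow_le_pow_iff_left₀ (norm_nonneg _) (Finset.sum_nonneg fun j _ => abs_nonneg _)
    two_ne_zero).1 ?_
  rw [EuclideanSpace.norm_sq_eq]
  exact Finset.sum_sq_le_sq_sum_of_nonneg fun j _ => abs_nonneg _

lemma weightedAvg_apply (a : ℕ → ℝ) (k : ℕ) (v : ℕ → E n) (j : Fin n) :
    weightedAvg a k v j = weightedAvg a k fun i => v i j := by
  simp [weightedAvg]

lemma hasGradientAt_weightedAvg (a : ℕ → ℝ) (k : ℕ) {φ : ℕ → E n → ℝ} {x : E n}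
    (hd : ∀ i, DifferentiableAt ℝ (φ i) x) :
    HasGradientAt (fun v => weightedAvg a k fun i => φ i v)
      (weightedAvg a k fun i => gradient (φ i) x) x := by
  rw [hasGradientAt_iff_hasFDerivAt]
  have h1 := (HasFDerivAt.fun_sum (u := Finset.range (k + 1)) fun i _ =>
    ((hd i).hasGradientAt.hasFDerivAt.const_smul (a i))).const_smul (weightSum a k)⁻¹
  refine h1.congr_fderiv ?_
  simp [weightedAvg, map_smul, map_sum]

variable {Ω : Type*} [MeasurableSpace Ω] {P : Measure Ω}

/-- The coordinatewise mean of the gradients of a family of functions. -/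
def meanGradient (P : Measure Ω) (u : E n → Ω → ℝ) (x : E n) : E n :=
  WithLp.toLp 2 fun j => ∫ t, gradient (fun y => u y t) x j ∂P

/-- A partial derivative is a limit of difference quotients along the sequence 1/(m + 1), each
measurable in the sample by integrability of u at fixed points. -/
lemma aemeasurable_gradient_apply {u : E n → Ω → ℝ} (hi : ∀ x, Integrable (u x) P) {x : E n}
    (hd : ∀ t, DifferentiableAt ℝ (fun y => u y t) x) (j : Fin n) :
    AEMeasurable (fun t => gradient (fun y => u y t) x j) P := by
  have hlim : Tendsto (fun m : ℕ => 1 / ((m : ℝ) + 1)) atTop (𝓝[>] 0) :=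
    tendsto_nhdsWithin_iff.2 ⟨tendsto_one_div_add_atTop_nhds_zero_nat,
      Eventually.of_forall fun m => by simp only [Set.mem_Ioi]; positivity⟩
  refine aemeasurable_of_tendsto_metrizable_ae atTop
    (f := fun (m : ℕ) t => (1 / ((m : ℝ) + 1))⁻¹ *
      (u (x + (1 / ((m : ℝ) + 1)) • EuclideanSpace.single j 1) t - u x t)) (fun m => ?_)
    (ae_of_all _ fun t => ?_)
  · exact ((hi _).aemeasurable.sub (hi _).aemeasurable).const_mul _
  · have h1 := (hasDerivAt_comp_line (hd t) (EuclideanSpace.single j 1)).tendsto_slope_zero_right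
    have h2 := h1.comp hlim
    rw [EuclideanSpace.inner_single_right] at h2
    simpa [Function.comp_def] using h2

lemma gradient_mem_subdiff_bound {Ω : Type*} {u : E n → Ω → ℝ}
    (hc : ∀ t, ConvexOn ℝ Set.univ fun x => u x t)
    (hu : BoundedEquicontinuous u) {C : Set (E n)} {R : ℝ} (hC : C ⊆ Metric.closedBall 0 R)
    (hd : ∀ x ∈ C, ∀ t, DifferentiableAt ℝ (fun y => u y t) x) :
    ∃ M : ℝ, ∀ x ∈ C, ∀ t, ‖gradient (fun y => u y t) x‖ ≤ M := by
  obtain ⟨M, hM0, hM⟩ := hu.exists_bound (isCompact_closedBall (0 : E n) (R + 1))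
  refine ⟨2 * M, fun x hx t => ?_⟩
  exact norm_le_of_mem_subdiff (gradient_mem_subdiff (hc t) (hd x hx t))
    (by simpa using hC hx) fun y hy => hM y hy t

variable [IsProbabilityMeasure P]

/-- The mean gradient is a subgradient of the mean. -/
lemma meanGradient_mem_subdiff {u : E n → Ω → ℝ} (hc : ∀ t, ConvexOn ℝ Set.univ fun x => u x t)
    (hi : ∀ x, Integrable (u x) P) {x : E n}
    (hd : ∀ t, DifferentiableAt ℝ (fun y => u y t) x) {M : ℝ}
    (hM : ∀ t, ‖gradient (fun y => u y t) x‖ ≤ M) :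
    meanGradient P u x ∈ subdiff (ext fun y => ∫ t, u y t ∂P) x := by
  refine mem_subdiff_ext_iff.2 fun y => ?_
  have hgi : ∀ j, Integrable (fun t => gradient (fun y => u y t) x j) P := fun j =>
    Integrable.of_bound (aemeasurable_gradient_apply hi hd j).aestronglyMeasurable M
      (ae_of_all _ fun t => (PiLp.norm_apply_le _ j).trans (hM t))
  have hinner : ∀ v : E n, inner ℝ v (y - x) = ∑ j, v j * (y - x) j := fun v => by
    simp [PiLp.inner_apply, mul_comm]
  have hsi : Integrable (fun t => ∑ j, gradient (fun y => u y t) x j * (y - x) j) P :=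
    integrable_finsetSum _ fun j _ => (hgi j).mul_const _
  have h1 : inner ℝ (meanGradient P u x) (y - x)
      = ∫ t, ∑ j, gradient (fun y => u y t) x j * (y - x) j ∂P := by
    rw [hinner, integral_finsetSum _ fun j _ => (hgi j).mul_const _]
    exact Finset.sum_congr rfl fun j _ => by rw [integral_mul_const]; rfl
  rw [h1, ← integral_add (hi x) hsi]
  refine integral_mono ((hi x).add hsi) (hi y) fun t => ?_
  have := mem_subdiff_ext_iff.1 (gradient_mem_subdiff (hc t) (hd t)) y
  rwa [hinner] at this

variable {Ω' : Type*} [MeasurableSpace Ω'] {μ : Measure Ω'} [IsProbabilityMeasure μ]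
  {a : ℕ → ℝ} {s : ℕ → Ω' → Ω}

/-- The expected uniform deviation of averaged gradients from the mean gradient. -/
lemma exists_gradient_deviation_bound (ha : ∀ k, 0 < a k) (hs : ∀ k, Measurable (s k))
    (hlaw : ∀ k, μ.map (s k) = P) (hind : iIndepFun s μ) {u : E n → Ω → ℝ}
    (hi : ∀ x, Integrable (u x) P)
    {C : Set (E n)} {R : ℝ} (hR : 0 ≤ R) (hC : C ⊆ Metric.closedBall 0 R)
    (hd : ∀ x ∈ C, ∀ t, DifferentiableAt ℝ (fun y => u y t) x) {M : ℝ}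
    (hM : ∀ x ∈ C, ∀ t, ‖gradient (fun y => u y t) x‖ ≤ M) {K : ℝ≥0}
    (hK : ∀ t, LipschitzOnWith K (gradient fun y => u y t) C) :
    ∃ c : ℝ, ∃ Z : ℕ → Ω' → ℝ, 0 ≤ c ∧ ∀ k, Integrable (Z k) μ ∧
      (∀ ω, ∀ x ∈ C, ‖weightedAvg a k (fun i => gradient (fun y => u y (s i ω)) x)
        - meanGradient P u x‖ ≤ Z k ω) ∧
      ∫ ω, Z k ω ∂μ ≤ c * rate a k := by
  -- The scalar deviation bound requires no convexity, so it applies to each gradient coordinate;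
  -- the coordinate bounds are then summed.
  have h1 := fun j : Fin n => exists_uniform_deviation_bound ha hs hlaw hind hR hC
    (u := fun x t => gradient (fun y => u y t) x j) (M := M) (Λ := K)
    (fun x hx => aemeasurable_gradient_apply hi (hd x hx) j)
    (fun x hx t => (PiLp.norm_apply_le _ j).trans (hM x hx t)) K.2
    fun x hx y hy t => by
      refine (PiLp.norm_apply_le (gradient (fun y => u y t) x - gradient (fun y => u y t) y) j).trans
        ?_
      simpa [dist_eq_norm] using (hK t).dist_le_mul x hx y hy
  choose c Z hc hZ using h1
  refine ⟨∑ j, c j, fun k ω => ∑ j, Z j k ω, Finset.sum_nonneg fun j _ => hc j, fun k =>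
    ⟨integrable_finsetSum _ fun j _ => (hZ j k).1, fun ω x hx => ?_, ?_⟩⟩
  · refine (norm_le_sum_abs _).trans (Finset.sum_le_sum fun j _ => ?_)
    have := (hZ j k).2.1 ω x hx
    rw [PiLp.sub_apply, weightedAvg_apply]
    exact this
  · rw [integral_finsetSum _ fun j _ => (hZ j k).1, Finset.sum_mul]
    exact Finset.sum_le_sum fun j _ => (hZ j k).2.2

end Gradients

/-! ### Expected steps, residual bounds and the convergence rate: part (ii). -/

section PartTwo

variable {n : ℕ} {Ω : Type*} [MeasurableSpace Ω] {P : Measure Ω}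
  {p : Program n P} {Ω' : Type*} [MeasurableSpace Ω'] {μ : Measure Ω'} [IsProbabilityMeasure μ]
  {alg : Scheme} {a : ℕ → ℝ} {x₀ : E n} {s : ℕ → Ω' → Ω} {x : ℕ → Ω' → E n}
  {z : ℕ → ℕ → Ω' → E n} {w : ℕ → Ω' → E n}

lemma IsRun.integrable_step_sq (hrun : IsRun p alg a μ x₀ s x z w) {R : ℝ}
    (hxR : ∀ᵐ ω ∂μ, ∀ k, ‖x k ω‖ ≤ R) (k : ℕ) :
    Integrable (fun ω => ‖x (k + 1) ω - x k ω‖ ^ 2) μ := by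
  refine Integrable.of_bound ((((hrun.iterate_measurable (k + 1)).sub
    (hrun.iterate_measurable k)).norm).pow_const 2).aestronglyMeasurable ((2 * R) ^ 2) ?_
  filter_upwards [hxR] with ω hω
  rw [norm_pow, norm_norm]
  refine pow_le_pow_left₀ (norm_nonneg _) ((norm_sub_le _ _).trans ?_) 2
  linarith [hω k, hω (k + 1)]

lemma IsRun.integrable_step (hrun : IsRun p alg a μ x₀ s x z w) {R : ℝ}
    (hxR : ∀ᵐ ω ∂μ, ∀ k, ‖x k ω‖ ≤ R) (k : ℕ) :
    Integrable (fun ω => ‖x (k + 1) ω - x k ω‖) μ := by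
  refine Integrable.of_bound (((hrun.iterate_measurable (k + 1)).sub
    (hrun.iterate_measurable k)).norm).aestronglyMeasurable (2 * R) ?_
  filter_upwards [hxR] with ω hω
  rw [norm_norm]
  refine (norm_sub_le _ _).trans ?_
  linarith [hω k, hω (k + 1)]

/-- The expected squared steps have bounded sums when the iterates are uniformly bounded. -/
lemma IsRun.exists_sum_integral_step_sq_le [IsProbabilityMeasure P]
    (ha : AdmissibleWeights a) (hreg : p.Regular alg)
    (hrun : IsRun p alg a μ x₀ s x z w) (hopt : p.FiniteOptimalValue) (hρ : 0 < p.modulus)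
    {R : ℝ} (hR : 0 ≤ R) (hxR : ∀ᵐ ω ∂μ, ∀ k, ‖x k ω‖ ≤ R) :
    ∃ V : ℝ, 0 ≤ V ∧ ∀ K, ∑ k ∈ Finset.range K, ∫ ω, ‖x (k + 1) ω - x k ω‖ ^ 2 ∂μ ≤ V := by
  obtain ⟨v, hv⟩ := hopt
  obtain ⟨ρ₁, ρ₂, hρ0, hρ₁, hρ₂⟩ := Program.exists_rhoConvex hρ
  obtain ⟨M, c, Z, φ, hE⟩ := exists_errorControl ha.pos hreg hrun hR
  have hρ0' : (0 : ℝ) < ((ρ₁ + ρ₂ : ℝ≥0) : ℝ) / 2 := half_pos (by exact_mod_cast hρ0)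
  set r : ℝ := ((ρ₁ + ρ₂ : ℝ≥0) : ℝ) / 2 with hr
  obtain ⟨T, hT⟩ : ∃ T, T = ∑' k, relWeight a (k + 1) * rate a k := ⟨_, rfl⟩
  have hstep := fun k => hrun.integrable_step_sq hxR k
  have hφm : ∀ k, Measurable fun ω => φ (x k ω) (s k ω) := fun k =>
    hE.measurable_φ.comp ((hrun.iterate_measurable k).prodMk (hrun.sample_measurable k))
  have hφi : ∀ k, Integrable (fun ω => φ (x k ω) (s k ω)) μ := fun k =>
    Integrable.of_bound (hφm k).aestronglyMeasurable (2 * M)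
      (ae_of_all _ fun ω => hE.abs_φ_le _ _)
  have hφ0 : ∀ k, ∫ ω, φ (x k ω) (s k ω) ∂μ = 0 := fun k => by
    have := integral_past_mul_centered hrun.sample_measurable hrun.iterate_measurable
      hrun.sample_law hrun.sample_fresh hE.measurable_φ hE.abs_φ_le hE.integral_φ k
      (ψ := fun _ => 1) measurable_const (B' := 1) (by simp)
    simpa using this
  have hei : ∀ k, Integrable (fun ω => relWeight a (k + 1) * Z k ω
      + relWeight a (k + 1) * φ (x (k + 1) ω) (s (k + 1) ω)) μ := fun k =>
    ((hE.integrable_Z k).const_mul _).add ((hφi (k + 1)).const_mul _)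
  -- The descent inequality is telescoped and integrated. The centered errors have mean zero, and
  -- comparing V_0 with f(x₀) and V_K with the optimal value costs 2M each, whence 4M.
  have hmain : ∀ K, r * ∑ k ∈ Finset.range K, ∫ ω, ‖x (k + 1) ω - x k ω‖ ^ 2 ∂μ
      ≤ p.realObjective x₀ - v + 4 * M + c * T := by
    intro K
    have h1 : ∀ᵐ ω ∂μ, r * ∑ k ∈ Finset.range K, ‖x (k + 1) ω - x k ω‖ ^ 2
        ≤ p.realObjective x₀ - v + 4 * M + ∑ k ∈ Finset.range K, (relWeight a (k + 1) * Z k ω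
          + relWeight a (k + 1) * φ (x (k + 1) ω) (s (k + 1) ω)) := by
      filter_upwards [hrun.ae_trajectory, hE.φ_eq, hxR] with ω hT hφ hxR
      have h2 := hE.value_succ_le ha.pos hρ₁ hρ₂ hT hφ hxR
      have h3 := hE.le_value hT hxR hv K
      set val := Program.Trajectory.value p alg a (fun i => s i ω) (fun k => x k ω) with hval
      have h4 : r * ∑ k ∈ Finset.range K, ‖x (k + 1) ω - x k ω‖ ^ 2 ≤ val 0 - val K
          + ∑ k ∈ Finset.range K, (relWeight a (k + 1) * Z k ω
            + relWeight a (k + 1) * φ (x (k + 1) ω) (s (k + 1) ω)) := by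
        clear h3
        induction K with
        | zero => simp
        | succ K ih =>
          rw [Finset.sum_range_succ, Finset.sum_range_succ]
          have := h2 K
          rw [← hr] at this
          linarith
      have h5 : val 0 ≤ p.realObjective x₀ + 2 * M := by
        have h6 := hE.deviation_le_bound (fun i => s i ω) 0 (x 0 ω) (by simpa using hxR 0)
        simp only [hval, Program.Trajectory.value]
        rw [hrun.start_eq] at h6 ⊢
        linarith [(abs_le.1 h6).1]
      linarith
    have h2 := integral_mono_ae
      ((integrable_finsetSum (Finset.range K) fun k _ => hstep k).const_mul r)
      ((integrable_const (p.realObjective x₀ - v + 4 * M)).add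
        (integrable_finsetSum (Finset.range K) fun k _ => hei k)) h1
    rw [integral_const_mul, integral_finsetSum _ fun k _ => hstep k] at h2
    refine h2.trans ?_
    have h3 : ∫ ω, ((p.realObjective x₀ - v + 4 * M) + ∑ k ∈ Finset.range K,
        (relWeight a (k + 1) * Z k ω + relWeight a (k + 1) * φ (x (k + 1) ω) (s (k + 1) ω))) ∂μ
        = (p.realObjective x₀ - v + 4 * M)
          + ∑ k ∈ Finset.range K, relWeight a (k + 1) * ∫ ω, Z k ω ∂μ := by
      rw [integral_add (integrable_const _) (integrable_finsetSum _ fun k _ => hei k),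
        integral_finsetSum _ fun k _ => hei k]
      simp only [integral_const, probReal_univ, one_smul]
      congr 1
      refine Finset.sum_congr rfl fun k _ => ?_
      rw [integral_add ((hE.integrable_Z k).const_mul _) ((hφi (k + 1)).const_mul _),
        integral_const_mul, integral_const_mul, hφ0, mul_zero, add_zero]
    refine h3.le.trans ?_
    have h4 : ∑ k ∈ Finset.range K, relWeight a (k + 1) * ∫ ω, Z k ω ∂μ ≤ c * T := by
      calc _ ≤ ∑ k ∈ Finset.range K, c * (relWeight a (k + 1) * rate a k) := by
            refine Finset.sum_le_sum fun k _ => ?_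
            have := mul_le_mul_of_nonneg_left (hE.integral_Z_le k)
              (relWeight_pos ha.pos (k + 1)).le
            linarith
        _ = c * ∑ k ∈ Finset.range K, relWeight a (k + 1) * rate a k := by rw [Finset.mul_sum]
        _ ≤ c * T := by
            refine mul_le_mul_of_nonneg_left ?_ hE.c_nonneg
            rw [hT]
            exact ha.summable_relWeight_mul_rate.sum_le_tsum _ fun k _ =>
              (mul_pos (relWeight_pos ha.pos (k + 1)) (rate_pos ha.pos k)).le
    linarith
  refine ⟨(p.realObjective x₀ - v + 4 * M + c * T) / r, ?_, fun K => ?_⟩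
  · have := hmain 0
    simp only [Finset.range_zero, Finset.sum_empty, mul_zero] at this
    positivity
  · rw [le_div_iff₀ hρ0', mul_comm]
    exact hmain K

/-- The residual at an iterate contains a point that is small in terms of the step and of the
deviation of the averaged gradients. -/
lemma exists_residual_bound [IsProbabilityMeasure P] (ha : ∀ k, 0 < a k) (hreg : p.Regular alg)
    (hrun : IsRun p alg a μ x₀ s x z w) {C : Set (E n)} {L : ℝ≥0} (hC : IsCompact C)
    (hxC : ∀ᵐ ω ∂μ, ∀ k, x k ω ∈ C) (hL : p.EquiLipschitzGradients L C alg) :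
    ∃ c : ℝ, ∃ Z : ℕ → Ω' → ℝ, 0 ≤ c ∧ (∀ k, Integrable (Z k) μ) ∧
      (∀ k, ∫ ω, Z k ω ∂μ ≤ c * rate a k) ∧
      ∀ᵐ ω ∂μ, ∀ k, 0 ≤ Z k ω ∧ Metric.infEDist 0 (p.residual (x (k + 1) ω))
        ≤ ENNReal.ofReal (Z k ω + L * ‖x (k + 1) ω - x k ω‖) := by
  obtain ⟨R, hR0, hR⟩ := hC.isBounded.subset_closedBall_lt 0 (0 : E n)
  have hLr : HasLipschitzGradientOn p.r₂ (L / 2) C := by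
    cases alg
    · exact hL.1
    · exact hL.1
  have hLh : ∀ t, HasLipschitzGradientOn (ext fun x => p.h x t) (L / 2) C := by
    cases alg
    · exact hL.2
    · exact hL.2.1
  have hhd : ∀ y ∈ C, ∀ t, DifferentiableAt ℝ (fun v => p.h v t) y := fun y hy t =>
    ((hLh t).1 y hy).2
  obtain ⟨Mh, hMh⟩ := gradient_mem_subdiff_bound p.h_convex hreg.h hR hhd
  obtain ⟨ch, Zh, hch, hZh⟩ := exists_gradient_deviation_bound ha hrun.sample_measurable
    hrun.sample_law hrun.sample_indep p.h_integrable hR0.le hR hhd hMh fun t => (hLh t).2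
  have hHsub : ∀ y ∈ C, meanGradient P p.h y ∈ subdiff (ext p.H) y := fun y hy =>
    meanGradient_mem_subdiff p.h_convex p.h_integrable (hhd y hy) (hMh y hy)
  have hLL : ((L / 2 : ℝ≥0) : ℝ) = L / 2 := by push_cast; ring
  -- The part of the bound that is common to both schemes.
  have common : ∀ ω, p.Trajectory alg a (fun i => s i ω) (fun k => x k ω) (fun k i => z k i ω)
      (fun k => w k ω) → (∀ k, x k ω ∈ C) → ∀ k,
      ‖weightedAvg a k (fun i => z k i ω) + w k ω - meanGradient P p.h (x (k + 1) ω)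
        - w (k + 1) ω‖ ≤ Zh k ω + L * ‖x (k + 1) ω - x k ω‖ := by
    intro ω hT hxC k
    have h1 : ‖w k ω - w (k + 1) ω‖ ≤ L / 2 * ‖x (k + 1) ω - x k ω‖ := by
      have h2 : ∀ k, w k ω = gradient (fun y => (p.r₂ y).toReal) (x k ω) := fun k =>
        eq_gradient_of_mem_subdiff p.r₂_ne_bot (hT.w_mem k) (hLr.1 _ (hxC k)).1
          (hLr.1 _ (hxC k)).2
      have h3 := hLr.2.dist_le_mul (x k ω) (hxC k) (x (k + 1) ω) (hxC (k + 1))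
      rw [← h2, ← h2, dist_eq_norm, dist_eq_norm, hLL, norm_sub_rev (x k ω)] at h3
      exact h3
    have h2 : ‖weightedAvg a k (fun i => z k i ω)
        - weightedAvg a k (fun i => gradient (fun y => p.h y (s i ω)) (x (k + 1) ω))‖
        ≤ L / 2 * ‖x (k + 1) ω - x k ω‖ := by
      rw [← weightedAvg_sub]
      refine norm_weightedAvg_le ha fun i hi => ?_
      have h3 : z k i ω = gradient (fun y => p.h y (s i ω)) (x k ω) :=
        eq_gradient_of_mem_subdiff (fun _ => EReal.coe_ne_bot _) (hT.z_mem k i hi)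
          ((hLh _).1 _ (hxC k)).1 ((hLh _).1 _ (hxC k)).2
      rw [h3]
      have h4 := (hLh (s i ω)).2.dist_le_mul (x k ω) (hxC k) (x (k + 1) ω) (hxC (k + 1))
      rw [dist_eq_norm, dist_eq_norm, hLL, norm_sub_rev (x k ω)] at h4
      exact h4
    have h3 := (hZh k).2.1 ω (x (k + 1) ω) (hxC (k + 1))
    calc _ = ‖(weightedAvg a k (fun i => z k i ω)
          - weightedAvg a k (fun i => gradient (fun y => p.h y (s i ω)) (x (k + 1) ω)))
          + (weightedAvg a k (fun i => gradient (fun y => p.h y (s i ω)) (x (k + 1) ω))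
            - meanGradient P p.h (x (k + 1) ω)) + (w k ω - w (k + 1) ω)‖ := by
          congr 1; abel
      _ ≤ _ := (norm_add₃_le).trans (by linarith)
  -- An element of the residual bounds the distance from the origin.
  have dist_le : ∀ y v : E n, v ∈ p.residual y → ∀ b : ℝ, ‖v‖ ≤ b →
      Metric.infEDist 0 (p.residual y) ≤ ENNReal.ofReal b := fun y v hv b hb => by
    refine (Metric.infEDist_le_edist_of_mem hv).trans ?_
    rw [edist_dist, dist_zero_left]
    exact ENNReal.ofReal_le_ofReal hb
  cases alg
  · refine ⟨ch, Zh, hch, fun k => (hZh k).1, fun k => (hZh k).2.2, ?_⟩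
    filter_upwards [hrun.ae_trajectory, hxC] with ω hT hxC k
    refine ⟨(norm_nonneg _).trans ((hZh k).2.1 ω _ (hxC k)), ?_⟩
    have hGc := Program.convexOn_integral p.g_convex p.g_integrable
    -- Optimality puts the averaged subgradient plus w^k in ∂G + ∂r₁ at x^{k+1}. Subtracting the
    -- mean gradient of h and w^{k+1}, both taken at x^{k+1}, gives an element of the residual; each
    -- gradient shift contributes L/2 times the step.
    obtain ⟨u, hu, hu'⟩ := exists_subgradient_add hGc (Program.continuous_of_convexOn hGc)
      p.r₁_ne_bot p.r₁_convex (hT.r₁_ne_top (k + 1)) (hT.optimal k)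
    refine dist_le _ _ ?_ _ (common ω hT hxC k)
    refine ⟨_, ⟨_, ⟨u, hu, _, hu', rfl⟩, _, hHsub _ (hxC (k + 1)), rfl⟩, _, hT.w_mem (k + 1), ?_⟩
    simp
  · have hLg := hL.2.2
    have hgd : ∀ y ∈ C, ∀ t, DifferentiableAt ℝ (fun v => p.g v t) y := fun y hy t =>
      ((hLg t).1 y hy).2
    obtain ⟨Mg, hMg⟩ := gradient_mem_subdiff_bound p.g_convex hreg.1 hR hgd
    obtain ⟨cg, Zg, hcg, hZg⟩ := exists_gradient_deviation_bound ha hrun.sample_measurable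
      hrun.sample_law hrun.sample_indep p.g_integrable hR0.le hR hgd hMg fun t => (hLg t).2
    refine ⟨cg + ch, fun k ω => Zg k ω + Zh k ω, add_nonneg hcg hch,
      fun k => (hZg k).1.add (hZh k).1, fun k => ?_, ?_⟩
    · rw [integral_add (hZg k).1 (hZh k).1, add_mul]
      exact add_le_add (hZg k).2.2 (hZh k).2.2
    filter_upwards [hrun.ae_trajectory, hxC] with ω hT hxC k
    refine ⟨add_nonneg ((norm_nonneg _).trans ((hZg k).2.1 ω _ (hxC k)))
      ((norm_nonneg _).trans ((hZh k).2.1 ω _ (hxC k))), ?_⟩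
    have hGc := Program.convexOn_weightedAvg ha p.g_convex (fun i => s i ω) k
    obtain ⟨u, hu, hu'⟩ := exists_subgradient_add hGc (Program.continuous_of_convexOn hGc)
      p.r₁_ne_bot p.r₁_convex (hT.r₁_ne_top (k + 1)) (hT.optimal k)
    have hgrad := hasGradientAt_weightedAvg a k
      (φ := fun i v => p.g v (s i ω)) fun i => hgd _ (hxC (k + 1)) (s i ω)
    have hu2 : u = weightedAvg a k fun i => gradient (fun v => p.g v (s i ω)) (x (k + 1) ω) := by
      rw [← hgrad.gradient]
      exact eq_gradient_of_mem_subdiff (fun _ => EReal.coe_ne_bot _) hu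
        (Eventually.of_forall fun y => ⟨EReal.coe_ne_top _, EReal.coe_ne_bot _⟩)
        hgrad.differentiableAt
    have hGsub : meanGradient P p.g (x (k + 1) ω) ∈ subdiff (ext p.G) (x (k + 1) ω) :=
      meanGradient_mem_subdiff p.g_convex p.g_integrable (hgd _ (hxC (k + 1)))
        (hMg _ (hxC (k + 1)))
    -- Here optimality involves the averaged gradient `u` of g instead of a subgradient of G;
    -- replacing it by the mean gradient costs one more deviation term.
    refine dist_le _ ((weightedAvg a k (fun i => z k i ω) + w k ω
        - meanGradient P p.h (x (k + 1) ω) - w (k + 1) ω)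
        - (u - meanGradient P p.g (x (k + 1) ω))) ?_ _ ?_
    · refine ⟨_, ⟨_, ⟨_, hGsub, _, hu', rfl⟩, _, hHsub _ (hxC (k + 1)), rfl⟩, _,
        hT.w_mem (k + 1), ?_⟩
      simp only
      abel
    · have h1 := (hZg k).2.1 ω _ (hxC (k + 1))
      rw [← hu2] at h1
      have h2 := common ω hT hxC k
      exact (norm_sub_le _ _).trans (by linarith)

lemma sum_Icc_one_eq_sum_range (f : ℕ → ℝ) (k : ℕ) :
    ∑ i ∈ Finset.Icc 1 k, f (i - 1) = ∑ i ∈ Finset.range k, f i := by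
  induction k with
  | zero => simp
  | succ k ih => rw [Finset.sum_Icc_succ_top (by omega), ih, Finset.sum_range_succ]; simp

/-- The rate of convergence of the criticality gap. -/
lemma exists_criticalityGap_sq_le [IsProbabilityMeasure P]
    (ha : AdmissibleWeights a) (hreg : p.Regular alg)
    (hrun : IsRun p alg a μ x₀ s x z w) (hopt : p.FiniteOptimalValue) (hρ : 0 < p.modulus)
    {C : Set (E n)} {L : ℝ≥0} (hC : IsCompact C)
    (hxC : ∀ᵐ ω ∂μ, ∀ k, x k ω ∈ C) (hL : p.EquiLipschitzGradients L C alg) :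
    ∃ c : ℝ, 0 ≤ c ∧ ∀ k : ℕ, 1 ≤ k → criticalityGap p μ x k ^ 2
      ≤ ENNReal.ofReal (c * (1 / (k : ℝ) * ∑ i ∈ Finset.range k, rate a i ^ 2)) := by
  obtain ⟨R, hR0, hR⟩ := hC.isBounded.subset_closedBall_lt 0 (0 : E n)
  have hxR : ∀ᵐ ω ∂μ, ∀ k, ‖x k ω‖ ≤ R := by
    filter_upwards [hxC] with ω hω k
    simpa using hR (hω k)
  obtain ⟨V, hV0, hV⟩ := hrun.exists_sum_integral_step_sq_le ha hreg hopt hρ hR0.le hxR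
  obtain ⟨c, Z, hc, hZi, hZ, hres⟩ := exists_residual_bound ha.pos hreg hrun hC hxC hL
  let δ : ℕ → ℝ := fun k => ∫ ω, ‖x (k + 1) ω - x k ω‖ ∂μ
  have hδ0 : ∀ k, 0 ≤ δ k := fun k => integral_nonneg fun ω => norm_nonneg _
  have hδ : ∀ k, δ k ^ 2 ≤ ∫ ω, ‖x (k + 1) ω - x k ω‖ ^ 2 ∂μ := by
    intro k
    have h1 := hrun.integrable_step hxR k
    have h2 := hrun.integrable_step_sq hxR k
    -- Nonnegativity of the variance of the step length.
    have h3 : 0 ≤ ∫ ω, (‖x (k + 1) ω - x k ω‖ ^ 2 - 2 * δ k * ‖x (k + 1) ω - x k ω‖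
        + δ k ^ 2) ∂μ := integral_nonneg fun ω => by
      simp only [Pi.zero_apply]
      nlinarith [sq_nonneg (‖x (k + 1) ω - x k ω‖ - δ k)]
    rw [integral_add (f := fun ω => ‖x (k + 1) ω - x k ω‖ ^ 2
      - 2 * δ k * ‖x (k + 1) ω - x k ω‖) (h2.sub (h1.const_mul _)) (integrable_const _),
      integral_sub h2 (h1.const_mul _), integral_const_mul] at h3
    simp only [integral_const, probReal_univ, one_smul] at h3
    change 0 ≤ _ - 2 * δ k * δ k + _ at h3
    nlinarith
  let e : ℕ → ℝ := fun k => c * rate a k + L * δ k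
  have he0 : ∀ k, 0 ≤ e k := fun k =>
    add_nonneg (mul_nonneg hc (rate_pos ha.pos k).le) (mul_nonneg L.2 (hδ0 k))
  have hgap : ∀ k, ∫⁻ ω, Metric.infEDist 0 (p.residual (x (k + 1) ω)) ∂μ
      ≤ ENNReal.ofReal (e k) := by
    intro k
    have h1 := (hrun.integrable_step hxR k).const_mul (L : ℝ)
    calc _ ≤ ∫⁻ ω, ENNReal.ofReal (Z k ω + L * ‖x (k + 1) ω - x k ω‖) ∂μ :=
          lintegral_mono_ae (hres.mono fun ω hω => (hω k).2)
      _ = ENNReal.ofReal (∫ ω, (Z k ω + L * ‖x (k + 1) ω - x k ω‖) ∂μ) := by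
          refine (ofReal_integral_eq_lintegral_ofReal ((hZi k).add h1) ?_).symm
          exact hres.mono fun ω hω => add_nonneg (hω k).1 (mul_nonneg L.2 (norm_nonneg _))
      _ ≤ _ := by
          refine ENNReal.ofReal_le_ofReal ?_
          rw [integral_add (hZi k) h1, integral_const_mul]
          exact add_le_add (hZ k) le_rfl
  have hr0 : 0 < rate a 0 := rate_pos ha.pos 0
  -- The constants 2 come from squaring a sum of two terms. The bound V on the summed squared steps
  -- is absorbed into the sum of squared rates, which is at least its first term.
  refine ⟨2 * c ^ 2 + 2 * (L : ℝ) ^ 2 * (V / rate a 0 ^ 2), by positivity, fun k hk => ?_⟩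
  have hk0 : (0 : ℝ) < k := by exact_mod_cast hk
  have hle : ∀ i ∈ Finset.range k, criticalityGap p μ x k ≤ ENNReal.ofReal (e i) := by
    intro i hi
    have hi' : i + 1 ∈ Finset.Icc 1 k := by
      simp only [Finset.mem_range, Finset.mem_Icc] at hi ⊢; omega
    exact (iInf₂_le (i + 1) hi').trans (hgap i)
  have hfin : criticalityGap p μ x k ≠ ∞ :=
    ne_top_of_le_ne_top ENNReal.ofReal_ne_top (hle 0 (Finset.mem_range.2 hk))
  obtain ⟨g, hg⟩ : ∃ g : ℝ≥0, criticalityGap p μ x k = g := ⟨_, (ENNReal.coe_toNNReal hfin).symm⟩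
  have hle' : ∀ i ∈ Finset.range k, (g : ℝ) ≤ e i := fun i hi => by
    have := hle i hi
    rw [hg] at this
    have h2 := ENNReal.toReal_mono ENNReal.ofReal_ne_top this
    rwa [ENNReal.toReal_ofReal (he0 i)] at h2
  set S := ∑ i ∈ Finset.range k, rate a i ^ 2 with hS
  have hS0 : rate a 0 ^ 2 ≤ S :=
    Finset.single_le_sum (f := fun i => rate a i ^ 2) (fun i _ => sq_nonneg _)
      (Finset.mem_range.2 hk)
  have h1 : (k : ℝ) * (g : ℝ) ^ 2 ≤ 2 * c ^ 2 * S + 2 * (L : ℝ) ^ 2 * V := by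
    calc (k : ℝ) * (g : ℝ) ^ 2 = ∑ _i ∈ Finset.range k, (g : ℝ) ^ 2 := by simp
      _ ≤ ∑ i ∈ Finset.range k, (2 * c ^ 2 * rate a i ^ 2
          + 2 * (L : ℝ) ^ 2 * ∫ ω, ‖x (i + 1) ω - x i ω‖ ^ 2 ∂μ) := by
          refine Finset.sum_le_sum fun i hi => ?_
          have h2 := pow_le_pow_left₀ g.2 (hle' i hi) 2
          have h3 : e i ^ 2 ≤ 2 * c ^ 2 * rate a i ^ 2 + 2 * (L : ℝ) ^ 2 * δ i ^ 2 := by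
            simp only [e]; nlinarith [sq_nonneg (c * rate a i - L * δ i)]
          have h4 := mul_le_mul_of_nonneg_left (hδ i) (by positivity : 0 ≤ 2 * (L : ℝ) ^ 2)
          exact h2.trans (h3.trans (by linarith))
      _ = 2 * c ^ 2 * S + 2 * (L : ℝ) ^ 2
          * ∑ i ∈ Finset.range k, ∫ ω, ‖x (i + 1) ω - x i ω‖ ^ 2 ∂μ := by
          rw [Finset.sum_add_distrib, ← Finset.mul_sum, ← Finset.mul_sum]
      _ ≤ _ := by
          have := mul_le_mul_of_nonneg_left (hV k) (by positivity : 0 ≤ 2 * (L : ℝ) ^ 2)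
          linarith
  have h2 : V ≤ V / rate a 0 ^ 2 * S := by
    rw [div_mul_eq_mul_div, le_div_iff₀ (by positivity)]
    exact mul_le_mul_of_nonneg_left hS0 hV0
  rw [hg]
  refine ENNReal.le_ofReal_iff_toReal_le (by simp) (by positivity) |>.2 ?_
  rw [ENNReal.toReal_pow, ENNReal.coe_toReal]
  have h3 : (k : ℝ) * (g : ℝ) ^ 2 ≤ (2 * c ^ 2 + 2 * (L : ℝ) ^ 2 * (V / rate a 0 ^ 2)) * S := by
    have := mul_le_mul_of_nonneg_left h2 (by positivity : 0 ≤ 2 * (L : ℝ) ^ 2)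
    linarith
  rw [one_div, ← mul_assoc, mul_comm _ ((k : ℝ)⁻¹), mul_assoc, ← div_eq_inv_mul,
    le_div_iff₀ hk0, mul_comm]
  exact h3

lemma beta_of_eq_one (h1 : ∀ k, a k = 1) (k : ℕ) : beta a k = Real.sqrt (k + 1) := by
  simp only [beta, weightSum, h1, one_pow, Finset.sum_const, Finset.card_range, nsmul_eq_mul,
    mul_one]
  push_cast
  exact Real.div_sqrt

/-- The sum of the squared rates for constant weights. -/
lemma sum_rate_sq_le (h1 : ∀ k, a k = 1) {k : ℕ} (hk : 3 ≤ k) :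
    ∑ i ∈ Finset.range k, rate a i ^ 2 ≤ 8 * Real.log k ^ 2 := by
  have hk0 : (0 : ℝ) < k := by exact_mod_cast (by omega : 0 < k)
  have hlog : 1 ≤ Real.log k := by
    rw [Real.le_log_iff_exp_le hk0]
    have h3 : (3 : ℝ) ≤ k := by exact_mod_cast hk
    linarith [Real.exp_one_lt_d9]
  -- From (1 + t)² ≤ 2 + 2t² with t² = log √(i + 1) ≤ log k, and 1 ≤ log k since k ≥ 3 > e. The
  -- harmonic sum supplies the second logarithm.
  have hterm : ∀ i ∈ Finset.range k, rate a i ^ 2 ≤ 4 * Real.log k * ((i : ℝ) + 1)⁻¹ := by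
    intro i hi
    have hi0 : (0 : ℝ) ≤ i := Nat.cast_nonneg i
    have hik : (i : ℝ) + 1 ≤ k := by exact_mod_cast Finset.mem_range.1 hi
    have h2 : 0 ≤ Real.log (Real.sqrt (i + 1)) :=
      Real.log_nonneg (Real.one_le_sqrt.2 (by linarith))
    have h3 : Real.log (Real.sqrt (i + 1)) ≤ Real.log k := by
      refine Real.log_le_log (by positivity) ?_
      have : Real.sqrt (i + 1) ≤ i + 1 := Real.sqrt_le_self_iff.2 (Or.inr (by linarith))
      linarith
    rw [rate, beta_of_eq_one h1, div_pow, Real.sq_sqrt (by positivity), div_eq_mul_inv]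
    gcongr
    nlinarith [Real.sq_sqrt h2, sq_nonneg (1 - Real.sqrt (Real.log (Real.sqrt (i + 1))))]
  have hharm : ∑ i ∈ Finset.range k, ((i : ℝ) + 1)⁻¹ ≤ 1 + Real.log k := by
    have := harmonic_le_one_add_log k
    rw [harmonic] at this
    push_cast at this
    exact this
  calc _ ≤ ∑ i ∈ Finset.range k, 4 * Real.log k * ((i : ℝ) + 1)⁻¹ := Finset.sum_le_sum hterm
    _ = 4 * Real.log k * ∑ i ∈ Finset.range k, ((i : ℝ) + 1)⁻¹ := by rw [Finset.mul_sum]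
    _ ≤ 4 * Real.log k * (1 + Real.log k) := by gcongr
    _ ≤ _ := by nlinarith

end PartTwo

end SDC

end

/-! ### The main theorem. -/

theorem mainTheorem2 {n : ℕ} {Ω : Type*} [MeasurableSpace Ω] (P : Measure Ω)
    [IsProbabilityMeasure P] (p : SDC.Program n P)
    {Ω' : Type*} [MeasurableSpace Ω'] (μ : Measure Ω') [IsProbabilityMeasure μ]
    (a : ℕ → ℝ) (ha : SDC.AdmissibleWeights a)
    (alg : SDC.Scheme) (hreg : p.Regular alg)
    (x₀ : SDC.E n) (s : ℕ → Ω' → Ω) (x : ℕ → Ω' → SDC.E n)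
    (z : ℕ → ℕ → Ω' → SDC.E n) (w : ℕ → Ω' → SDC.E n)
    (hrun : SDC.IsRun p alg a μ x₀ s x z w)
    (hopt : p.FiniteOptimalValue)
    (hbdd : ∀ᵐ ω ∂μ, BddAbove (Set.range fun k => ‖x k ω‖))
    (hρ : 0 < p.modulus) :
    -- (i)
    ((∀ᵐ ω ∂μ, ∃ l : ℝ, Tendsto (fun k => p.objective (x k ω)) atTop (𝓝 (l : EReal))) ∧
      (∀ᵐ ω ∂μ, Summable fun k => ‖x (k + 1) ω - x k ω‖ ^ 2) ∧
      (∀ᵐ ω ∂μ, BddAbove (Set.range fun k => ‖w k ω‖) →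
        ∀ y : SDC.E n, MapClusterPt y atTop (fun k => x k ω) → p.IsCritical y)) ∧
    -- (ii)
    (∀ (C : Set (SDC.E n)) (L : ℝ≥0), IsCompact C → (∀ᵐ ω ∂μ, ∀ k, x k ω ∈ C) →
      p.EquiLipschitzGradients L C alg →
      (∃ c : ℝ, ∀ᶠ k : ℕ in atTop,
        SDC.criticalityGap p μ x k ^ 2 ≤ ENNReal.ofReal (c * (1 / (k : ℝ) *
          ∑ i ∈ Finset.Icc 1 k,
            (1 + Real.sqrt (Real.log (SDC.beta a (i - 1)))) ^ 2 / SDC.beta a (i - 1) ^ 2))) ∧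
      ((∀ k, a k = 1) →
        ∃ c : ℝ, ∀ᶠ k : ℕ in atTop,
          SDC.criticalityGap p μ x k ≤
            ENNReal.ofReal (c * (Real.log k / Real.sqrt k)))) := by
  have hi := hrun.ae_tendsto_and_summable ha hreg hopt hbdd hρ
  refine ⟨⟨hi.mono fun ω h => h.1, hi.mono fun ω h => h.2,
    hrun.ae_isCritical ha hreg hbdd (hi.mono fun ω h => h.2)⟩, fun C L hC hxC hL => ?_⟩
  obtain ⟨c, hc, hgap⟩ := SDC.exists_criticalityGap_sq_le ha hreg hrun hopt hρ hC hxC hL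
  refine ⟨⟨c, ?_⟩, fun h1 => ⟨Real.sqrt (8 * c), ?_⟩⟩
  · filter_upwards [eventually_ge_atTop 1] with k hk
    refine (hgap k hk).trans_eq ?_
    rw [← SDC.sum_Icc_one_eq_sum_range]
    simp only [SDC.rate, div_pow]
  · filter_upwards [eventually_ge_atTop 3] with k hk
    have hk0 : (0 : ℝ) < k := by exact_mod_cast (by omega : 0 < k)
    have hlog : 0 ≤ Real.log k := Real.log_nonneg (by exact_mod_cast (by omega : 1 ≤ k))
    -- The bound is compared after squaring: c/k times the sum of squared rates is at most 8c log² k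
    -- / k, which explains the constant √(8c).
    rw [← ENNReal.pow_le_pow_left_iff two_ne_zero, ← ENNReal.ofReal_pow (by positivity)]
    refine (hgap k (by omega)).trans (ENNReal.ofReal_le_ofReal ?_)
    rw [mul_pow, div_pow, Real.sq_sqrt (by positivity), Real.sq_sqrt hk0.le]
    have h2 := SDC.sum_rate_sq_le h1 hk
    calc _ ≤ c * (1 / (k : ℝ) * (8 * Real.log k ^ 2)) := by gcongr
      _ = _ := by ring
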